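/- **Conventions.** Let $T^2=(\mathbb R/2\pi\mathbb Z)^2$ with coordinates $(x,y)$, and put $u=\frac{t+y}{2}$, $v=\frac{t-y}{2}$. A *Ward map* $J:T^2\times\mathbb R\to SU(2)$ is a smooth solution of $$(J^{-1}J_t)_t-(J^{-1}J_x)_x-(J^{-1}J_y)_y-[J^{-1}J_t,J^{-1}J_y]=0 .$$ Writing $\delta J=J\eta$, the linearization of this equation at $J$ is $$(\eta_t+[J^{-1}J_t,\eta])_t-(\eta_x+[J^{-1}J_x,\eta])_x-(\eta_y+[J^{-1}J_y,\eta])_y-[\eta_t+[J^{-1}J_t,\eta],J^{-1}J_y]-[J^{-1}J_t,\eta_y+[J^{-1}J_y,\eta]]=0 .$$ A *linear mode* with exponent $\gamma\in\mathbb C$ at a stationary ($t$-independent) Ward map $L$ is a nonzero function $\eta=e^{\gamma t}Z-(e^{\gamma t}Z)^*$, where $Z:T^2\to sl(2,\mathbb C)$ is smooth and $e^{\gamma t}Z(x,y)$ solves the linearization at $L$; it is *unstable* if $\operatorname{Re}\gamma>0$ and *stable* if $\operatorname{Re}\gamma<0$. A Ward map $J:T^2\times\mathbb R\to SU(2)$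 is *homoclinic* to $L$ if $J\to L$ as $t\to\pm\infty$, if $J=L(I+\eta^+)+o(e^{t\operatorname{Re}\gamma_+})$ as $t\to-\infty$ for some unstable mode $\eta^+$ at $L$ with exponent $\gamma_+$, and if $J=L(I+\eta^-)+o(e^{t\operatorname{Re}\gamma_-})$ as $t\to+\infty$ for some stable mode $\eta^-$ at $L$ with exponent $\gamma_-$; limits and remainders are understood for the functions and all their partial derivatives, uniformly on $T^2$. For $z\in\mathbb C\setminus\mathbb R$, a Hermitian-projection-valued function $\pi(x,y,t)$ of rank one, a matrix function $\psi(x,y,t,\lambda)$ and $J(x,y,t)$, let $\tilde\pi(x,y,t)$ be the Hermitian projection of $\mathbb C^2$ onto $\psi(x,y,t,z)\,\mathrm{Im}\,\pi(x,y,t)$, and define the *Bäcklund transformation* $$h_{z,\pi}*\psi=\Big(I+\frac{\bar z-z}{\lambda-\bar z}\,\tilde\pi\Big)\psi,\qquad h_{z,\pi}*J=\frac{z}{|z|}\,J\,\Big(\frac{\bar z}{z}\,\tilde\pi+(I-\tilde\pi)\Big).$$ When transformations are applied to $J$ successively, each one uses the current function $\psi$, which is then transformed as well. **Theorem.** Let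 $m$ be a nonzero integer, $a=\mathrm{diag}(im,-im)$, $J_0=e^{-(x+y)a}$, and $\psi_0=e^{((1-\lambda)x+(1+\lambda-\lambda^2)u-v)a}$ (so that $J_0=\psi_0|_{\lambda=0}^{-1}$). Let $N\ge 1$ and choose $(j_{2k-1},l_{2k-1})\in\mathbb Z^2$, $1\le k\le N$, pairwise distinct, with $$(j_{2k-1}-m)^2+(l_{2k-1}-m)^2<m^2,\qquad l_{2k-1}>m .$$ Put $(j_{2k},l_{2k})=(j_{2k-1},2m-l_{2k-1})$. For $s=1,\dots,2N$ let $z_s=\sqrt{\frac{2m-j_s}{j_s}}\,e^{i\theta_s}$ with $$\cos\theta_s=\mathrm{sgn}(m)\frac{l_s-m}{\sqrt{j_s(2m-j_s)}},\qquad \sin\theta_s=\mathrm{sgn}(m)\sqrt{1-\cos^2\theta_s},$$ and let $\pi_s(x,y,t)$ be the Hermitian projection onto $\mathbb C\binom{1}{f_s(w_s)}$, where $f_s(w)=e^{i(2m-j_s-2mz_s)w}$ and $w_s=x+z_su+z_s^{-1}v$. Let $$J_{2N}=h_{z_{2N},\pi_{2N}}*(\cdots*(h_{z_1,\pi_1}*J_0)\cdots)$$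 be the map obtained by applying these $2N$ Bäcklund transformations to $J_0$, starting from $\psi_0$. Then $J_{2N}$ is a Ward map from $T^2\times\mathbb R$ to $SU(2)$, it is homoclinic to the stationary Ward map $(-1)^NJ_0$, and in particular $J_{2N}\to(-1)^NJ_0$ as $t\to\pm\infty$. -/

import Mathlib

open scoped ContDiff Matrix ComplexConjugate

noncomputable section

/-- Matrix-valued functions of the space-time variables `(x, y, t)`. -/
abbrev MatField (n : ℕ) : Type := ℝ → ℝ → ℝ → Matrix (Fin n) (Fin n) ℂ

/-- Functions of `(x, y, t)` and of the spectral parameter. -/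
abbrev ExtField (n : ℕ) : Type := ℝ → ℝ → ℝ → ℂ → Matrix (Fin n) (Fin n) ℂ

namespace Ward

variable {n : ℕ}

/-! ### Calculus of matrix-valued functions, entry by entry -/

/-- All entries are smooth functions on `ℝ³`. -/
def Smooth (F : MatField n) : Prop :=
  ∀ a b, ContDiff ℝ ∞ (fun p : ℝ × ℝ × ℝ => F p.1 p.2.1 p.2.2 a b)

/-- The partial derivative in `x`. -/
def dx (F : MatField n) : MatField n := fun x y t => Matrix.of fun a b => deriv (fun s => F s y t a b) x

/-- The partial derivative in `y`. -/
def dy (F : MatField n) : MatField n := fun x y t => Matrix.of fun a b => deriv (fun s => F x s t a b) y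

/-- The partial derivative in `t`. -/
def dt (F : MatField n) : MatField n := fun x y t => Matrix.of fun a b => deriv (fun s => F x y s a b) t

/-- The pointwise commutator `[F, G]`. -/
def comm (F G : MatField n) : MatField n := fun x y t => F x y t * G x y t - G x y t * F x y t

/-- The pointwise product `J⁻¹ F`. -/
def invMul (J F : MatField n) : MatField n := fun x y t => (J x y t)⁻¹ * F x y t

/-- `F` is `2π`-periodic in `x` and in `y`, that is, a function on `T² × ℝ`. -/
def DoublyPeriodic (F : MatField n) : Prop :=
  ∀ x y t, F (x + 2 * Real.pi) y t = F x y t ∧ F x (y + 2 * Real.pi) t = F x y t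

/-! ### Ward maps and the linearized Ward equation -/

/-- `(J⁻¹J_t)_t - (J⁻¹J_x)_x - (J⁻¹J_y)_y - [J⁻¹J_t, J⁻¹J_y]`. -/
def wardOp (J : MatField n) : MatField n :=
  dt (invMul J (dt J)) - dx (invMul J (dx J)) - dy (invMul J (dy J))
    - comm (invMul J (dt J)) (invMul J (dy J))

/-- A (smooth) Ward map `T² × ℝ → SU(n)`. -/
structure IsTorusWardMap (J : MatField n) : Prop where
  smooth : Smooth J
  periodic : DoublyPeriodic J
  mem_SU : ∀ x y t, J x y t ∈ Matrix.specialUnitaryGroup (Fin n) ℂ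
  ward : ∀ x y t, wardOp J x y t = 0

/-- The Ward map does not depend on `t`. -/
def IsStationary (J : MatField n) : Prop := ∀ x y t, J x y t = J x y 0

/-- The linearization of `wardOp` at `J` in the direction `δJ = J η`, where the variation of
`J⁻¹J_x` is `η_x + [J⁻¹J_x, η]`, and likewise for `y` and `t`. -/
def linWardOp (J η : MatField n) : MatField n :=
  let P := invMul J (dx J)
  let Q := invMul J (dy J)
  let R := invMul J (dt J)
  let ηx := dx η + comm P η
  let ηy := dy η + comm Q η
  let ηt := dt η + comm R η
  dt ηt - dx ηx - dy ηy - comm ηt Q - comm R ηy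

/-- The separated function `e^{γ t} Z(x, y)`. -/
def modeField (γ : ℂ) (Z : ℝ → ℝ → Matrix (Fin n) (Fin n) ℂ) : MatField n :=
  fun x y t => Complex.exp (γ * t) • Z x y

/-- The `su(n)`-valued part `e^{γ t} Z - (e^{γ t} Z)ᴴ` of a separated function. -/
def realMode (γ : ℂ) (Z : ℝ → ℝ → Matrix (Fin n) (Fin n) ℂ) : MatField n :=
  fun x y t => modeField γ Z x y t - (modeField γ Z x y t)ᴴ

/-- `η` is a (nonzero, `su(n)`-valued) linear mode with exponent `γ` of the Ward equation at the
stationary solution `J`: it is the `su(n)`-part of a solution `e^{γ t} Z(x, y)`, with `Z` doubly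
periodic and trace-free, of the linearized equation. The mode is unstable if `0 < Re γ` and stable
if `Re γ < 0`. -/
def IsLinearMode (J : MatField n) (γ : ℂ) (η : MatField n) : Prop :=
  ∃ Z : ℝ → ℝ → Matrix (Fin n) (Fin n) ℂ,
    Smooth (modeField γ Z) ∧ DoublyPeriodic (modeField γ Z) ∧ (∀ x y, (Z x y).trace = 0) ∧
    (∀ x y t, linWardOp J (modeField γ Z) x y t = 0) ∧ η = realMode γ Z ∧ η ≠ 0

/-! ### Asymptotics and homoclinic Ward maps -/

/-- Along the filter `l` of times, `F = o(g(t))` together with all its partial derivatives of all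
orders, uniformly in `(x, y)`. -/
def SmoothLittleO (l : Filter ℝ) (F : MatField n) (g : ℝ → ℝ) : Prop :=
  ∀ (k : ℕ) (ε : ℝ), 0 < ε → ∀ᶠ t in l, ∀ x y a b,
    ‖iteratedFDeriv ℝ k (fun p : ℝ × ℝ × ℝ => F p.1 p.2.1 p.2.2 a b) (x, y, t)‖ ≤ ε * g t

/-- `J → L` along the filter `l` of times, in the `C^∞` topology, uniformly on `T²`. -/
def ConvergesTo (l : Filter ℝ) (J L : MatField n) : Prop :=
  SmoothLittleO l (J - L) (fun _ => 1)

/-- `J` is tangent to the mode `η` of exponent `γ` at `L`: `J = L (1 + η) + o(e^{t Re γ})`. -/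
def TangentTo (l : Filter ℝ) (J L : MatField n) (γ : ℂ) (η : MatField n) : Prop :=
  SmoothLittleO l (fun x y t => J x y t - L x y t * (1 + η x y t)) (fun t => Real.exp (γ.re * t))

/-- The Ward map `J : T² × ℝ → SU(n)` is homoclinic to the stationary Ward map `L`: it tends to `L`
as `t → ±∞`, it is tangent to an unstable linear mode of `L` as `t → -∞`, and to a stable linear
mode of `L` as `t → +∞`. -/
structure IsHomoclinicTo (J L : MatField n) : Prop where
  wardMap : IsTorusWardMap J
  limit_wardMap : IsTorusWardMap L
  limit_stationary : IsStationary L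
  tendsto_neg : ConvergesTo Filter.atBot J L
  tendsto_pos : ConvergesTo Filter.atTop J L
  unstable : ∃ γ η, 0 < γ.re ∧ IsLinearMode L γ η ∧ TangentTo Filter.atBot J L γ η
  stable : ∃ γ η, γ.re < 0 ∧ IsLinearMode L γ η ∧ TangentTo Filter.atTop J L γ η

/-! ### Bäcklund transformations -/

/-- The matrix of the Hermitian projection of `ℂⁿ` onto the subspace `W`. -/
def hermProj (W : Submodule ℂ (EuclideanSpace ℂ (Fin n))) : Matrix (Fin n) (Fin n) ℂ :=
  Matrix.toEuclideanLin.symm (W.starProjection : EuclideanSpace ℂ (Fin n) →ₗ[ℂ] _)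

/-- `h_{z,π}(μ) = 1 + (z̄ - z) / (μ - z̄) π`. -/
def simpleFactor (z : ℂ) (p : Matrix (Fin n) (Fin n) ℂ) (μ : ℂ) : Matrix (Fin n) (Fin n) ℂ :=
  1 + ((conj z - z) / (μ - conj z)) • p

/-- `π̃`: the Hermitian projection onto `ψ(x, y, t, z) (Im π(x, y, t))`. -/
def transformedProj (z : ℂ) (p : MatField n) (ψ : ExtField n) : MatField n := fun x y t =>
  hermProj (Submodule.map (Matrix.toEuclideanLin (ψ x y t z))
    (LinearMap.range (Matrix.toEuclideanLin (p x y t))))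

/-- The Bäcklund transform `h_{z,π} * ψ = h_{z,π̃} ψ` of the extended solution `ψ`. -/
def backlundExt (z : ℂ) (p : MatField n) (ψ : ExtField n) : ExtField n := fun x y t μ =>
  simpleFactor z (transformedProj z p ψ x y t) μ * ψ x y t μ

/-- The Bäcklund transform `h_{z,π} * J` of the Ward map `J : ℝ³ → SU(2)` associated with the
extended solution `ψ`, for `π` of rank one:
`(z / z̄)^{1/2} J ((z̄ / z) π̃ + π̃^⊥) = J (z̄ π̃ + z π̃^⊥) / |z|`,
with the branch `(z / z̄)^{1/2} = z / |z| = e^{i arg z}` of the normalizing constant. -/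
def backlundMap (z : ℂ) (p : MatField 2) (ψ : ExtField 2) (J : MatField 2) : MatField 2 := fun x y t =>
  (z / (‖z‖ : ℂ)) • (J x y t *
    ((conj z / z) • transformedProj z p ψ x y t + (1 - transformedProj z p ψ x y t)))

/-- `s` successive Bäcklund transformations of `ψ`, with data `(z 1, p 1), …, (z s, p s)`. -/
def iterExt (z : ℕ → ℂ) (p : ℕ → MatField 2) (ψ : ExtField 2) : ℕ → ExtField 2
  | 0 => ψ
  | s + 1 => backlundExt (z (s + 1)) (p (s + 1)) (iterExt z p ψ s)

/-- `s` successive Bäcklund transformations of the Ward map `J` with extended solution `ψ`. -/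
def iterMap (z : ℕ → ℂ) (p : ℕ → MatField 2) (ψ : ExtField 2) (J : MatField 2) : ℕ → MatField 2
  | 0 => J
  | s + 1 => backlundMap (z (s + 1)) (p (s + 1)) (iterExt z p ψ s) (iterMap z p ψ J s)

/-! ### The data -/

/-- `a = diag(im, -im)`. -/
def aMat (m : ℤ) : Matrix (Fin 2) (Fin 2) ℂ :=
  Matrix.diagonal ![Complex.I * m, -(Complex.I * m)]

/-- `J₀ = e^{-(x+y)a}`. -/
def vacuumMap (m : ℤ) : MatField 2 := fun x y _ => NormedSpace.exp (-((x : ℂ) + y) • aMat m)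

/-- The extended solution `e^{((1-μ)x + (1+μ-μ²)u - v)a}` of `J₀`, where `u = (t+y)/2` and
`v = (t-y)/2`. -/
def vacuumExt (m : ℤ) : ExtField 2 := fun x y t μ =>
  NormedSpace.exp
    (((1 - μ) * x + (1 + μ - μ ^ 2) * (((t : ℂ) + y) / 2) - ((t : ℂ) - y) / 2) • aMat m)

/-- `w = x + z u + z⁻¹ v`, where `u = (t+y)/2` and `v = (t-y)/2`. -/
def wCoord (z : ℂ) (x y t : ℝ) : ℂ := x + z * (((t : ℂ) + y) / 2) + z⁻¹ * (((t : ℂ) - y) / 2)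

/-- The pole `z = √((2m-j)/j) e^{iθ}`. -/
def pole (m j : ℤ) (θ : ℝ) : ℂ :=
  (Real.sqrt ((2 * m - j) / j) : ℂ) * Complex.exp (Complex.I * θ)

/-- `f(w) = e^{i(2m - j - 2mz)w}`. -/
def seedFun (m j : ℤ) (z w : ℂ) : ℂ := Complex.exp (Complex.I * (2 * m - j - 2 * m * z) * w)

/-- The Hermitian projection onto `ℂ (1, f(w))ᵀ`, as a function of `(x, y, t)`. -/
def seedProj (m j : ℤ) (z : ℂ) : MatField 2 := fun x y t =>
  hermProj (Submodule.span ℂ {!₂[(1 : ℂ), seedFun m j z (wCoord z x y t)]})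

/-- The map `J_M` obtained from `J₀` by the `M` Bäcklund transformations with the poles
`z_s = √((2m-j_s)/j_s) e^{iθ_s}` and the projections `π_s` onto `ℂ (1, f_s(w_s))ᵀ`,
`s = 1, …, M`. -/
def solitonMap (m : ℤ) (j : ℕ → ℤ) (θ : ℕ → ℝ) (M : ℕ) : MatField 2 :=
  iterMap (fun s => pole m (j s) (θ s)) (fun s => seedProj m (j s) (pole m (j s) (θ s)))
    (vacuumExt m) (vacuumMap m) M

end Ward

end

/-! The Ward equation is the compatibility condition of the Lax pair (μ∂_x − ∂_u)ψ = Aψ, (μ∂_v −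
∂_x)ψ = Bψ with A = J⁻¹J_u and B = J⁻¹J_x. Write the successive Bäcklund transforms of ψ₀ as ψ =
Gψ₀, where G (`dressing`) is a product of simple factors. The seeds f_s are chosen so that
ψ₀(z_s)(1, f_s)ᵀ is a scalar multiple of (1, q_s)ᵀ, where q_s = exp(−i j_s x − i l_s y + (σ_s −
im)t) and σ_s = √(m² − (j_s−m)² − (l_s−m)²) > 0 (`transformedProj_seedProj`). Hence G is rational in
the doubly periodic waves q_s and their conjugates. It has no singularities: its determinant is a
Blaschke product (`det_dressing`), nonzero wherever the next projection needs it, because the poles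
are distinct and none is conjugate to another or to itself. Each factor preserves the Lax pair
(`projection_equation`, `simpleFactor_lax`, `map_lax`), so the dressed map is a Ward map
(`exists_lax_dressing`, `wardOp_eq_zero`).

For the asymptotics, J is multiplied at each step by the normalized inverse of the simple factor at
μ = 0. So J·G(0) = ∏ z_s/|z_s| · J₀, and the pairing z_{2k} = −z̄_{2k−1} makes the constant (−1)^N.
Thus J = (−1)^N J₀ G(0)* with G(0) in SU(2). As t → −∞ every |q_s| = e^{σ_s t} tends to 0, and
`dressing_asymptotics` expands G: its diagonal is (B(μ), 1) up to quadratic errors, with B the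
Blaschke product and B(0) = 1 by the pairing; its lower left entry is ∑ c_r q_r plus a quadratic
error, with every c_r ≠ 0. Exchanging the two coordinates of ℂ² replaces each q_s by 1/q_s
(`dressing_eq_swapMat`), so the same expansion serves t → +∞.

At first order G(0)* − 1 thus has upper right entry a combination of waves e^{i(jx+ly)+(±σ+im)t},
and membership in SU(2) fixes the other entries. These waves satisfy the dispersion relation of the
linearized equation (`linWardOp_upper_waveSum`). Several of them may share the smallest σ (the two
members of a pair always have equal σ), so the tangent mode is the sum of all slowest waves, which
is nonzero because distinct characters are linearly independent (`exists_waveSum_ne_zero`). Faster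
waves and quadratic terms are of smaller order (`exists_tangent_mode`). -/

namespace Ward

variable {n : ℕ}

/-! ### Calculus of matrix fields -/

/-- The entry `(a, b)` of a matrix field, as a function on `ℝ³`. -/
def entry (F : MatField n) (a b : Fin n) : ℝ × ℝ × ℝ → ℂ := fun p => F p.1 p.2.1 p.2.2 a b

/-- The derivative of a matrix field in the direction of the constant vector `v`. -/
noncomputable def dir (v : ℝ × ℝ × ℝ) (F : MatField n) : MatField n :=
  fun x y t => Matrix.of fun a b => fderiv ℝ (entry F a b) (x, y, t) v

theorem entry_mul (F G : MatField n) (a b : Fin n) :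
    entry (F * G) a b = ∑ c, entry F a c * entry G c b := by
  funext p
  simp [entry, Matrix.mul_apply]

theorem smooth_iff {F : MatField n} : Smooth F ↔ ∀ a b, ContDiff ℝ ∞ (entry F a b) := Iff.rfl

theorem Smooth.differentiable {F : MatField n} (hF : Smooth F) (a b : Fin n) :
    Differentiable ℝ (entry F a b) :=
  (smooth_iff.1 hF a b).differentiable (by simp)

theorem Smooth.add {F G : MatField n} (hF : Smooth F) (hG : Smooth G) : Smooth (F + G) :=
  fun a b => (hF a b).add (hG a b)

theorem Smooth.const_smul {F : MatField n} (c : ℂ) (hF : Smooth F) : Smooth (c • F) :=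
  fun a b => (hF a b).const_smul c

theorem Smooth.mul {F G : MatField n} (hF : Smooth F) (hG : Smooth G) : Smooth (F * G) := by
  intro a b
  have h : ContDiff ℝ ∞ (entry (F * G) a b) := by
    rw [entry_mul]
    have := ContDiff.sum (𝕜 := ℝ) (n := ∞) (s := Finset.univ)
      (f := fun c => entry F a c * entry G c b) fun c _ => (hF a c).mul (hG c b)
    convert this using 1
    funext p
    simp
  exact h

theorem smooth_const (A : Matrix (Fin n) (Fin n) ℂ) : Smooth (fun _ _ _ => A : MatField n) :=
  fun _ _ => contDiff_const

theorem smooth_one : Smooth (1 : MatField n) := smooth_const 1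

theorem Smooth.star {F : MatField n} (hF : Smooth F) : Smooth (star F) :=
  fun a b => Complex.conjCLE.contDiff.comp (hF b a)

theorem Smooth.dir {F : MatField n} (hF : Smooth F) (v : ℝ × ℝ × ℝ) : Smooth (dir v F) := by
  intro a b
  have h : ContDiff ℝ ∞ (entry F a b) := hF a b
  exact (h.fderiv_right (m := ∞) (by simp)).clm_apply contDiff_const

theorem dir_add {F G : MatField n} (hF : Smooth F) (hG : Smooth G) (v : ℝ × ℝ × ℝ) :
    dir v (F + G) = dir v F + dir v G := by
  funext x y t
  ext a b
  have := fderiv_add (hF.differentiable a b (x, y, t)) (hG.differentiable a b (x, y, t))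
  exact congrArg (fun L => L v) this

theorem dir_const_smul {F : MatField n} (c : ℂ) (hF : Smooth F) (v : ℝ × ℝ × ℝ) :
    dir v (c • F) = c • dir v F := by
  funext x y t
  ext a b
  have := fderiv_const_smul (hF.differentiable a b (x, y, t)) c
  exact congrArg (fun L => L v) this

theorem dir_mul {F G : MatField n} (hF : Smooth F) (hG : Smooth G) (v : ℝ × ℝ × ℝ) :
    dir v (F * G) = dir v F * G + F * dir v G := by
  funext x y t
  ext a b
  change fderiv ℝ (entry (F * G) a b) (x, y, t) v = _
  rw [entry_mul, fderiv_sum fun c _ => (hF.differentiable a c _).mul (hG.differentiable c b _)]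
  simp only [sum_apply, Pi.add_apply, Matrix.add_apply, Pi.mul_apply,
    Matrix.mul_apply, ← Finset.sum_add_distrib]
  refine Finset.sum_congr rfl fun c _ => ?_
  rw [fderiv_mul (hF.differentiable a c _) (hG.differentiable c b _)]
  simp only [add_apply, smul_apply, smul_eq_mul]
  change F x y t a c * _ + G x y t c b * _ = _ * G x y t c b + F x y t a c * _
  rw [add_comm, mul_comm (G x y t c b)]
  rfl

theorem dir_const (A : Matrix (Fin n) (Fin n) ℂ) (v : ℝ × ℝ × ℝ) :
    dir v (fun _ _ _ => A : MatField n) = 0 := by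
  funext x y t
  ext a b
  change fderiv ℝ (fun _ => A a b) (x, y, t) v = 0
  simp

theorem dir_one (v : ℝ × ℝ × ℝ) : dir v (1 : MatField n) = 0 := dir_const 1 v

theorem dir_star {F : MatField n} (hF : Smooth F) (v : ℝ × ℝ × ℝ) :
    dir v (star F) = star (dir v F) := by
  funext x y t
  ext a b
  change fderiv ℝ (Complex.conjCLE ∘ entry F b a) (x, y, t) v = _
  have h := (Complex.conjCLE.toContinuousLinearMap.hasFDerivAt (x := entry F b a (x, y, t))).comp
    (x, y, t) (hF.differentiable b a _).hasFDerivAt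
  exact congrArg (fun L => L v) h.fderiv

theorem dir_comm {F : MatField n} (hF : Smooth F) (v w : ℝ × ℝ × ℝ) :
    dir v (dir w F) = dir w (dir v F) := by
  funext x y t
  ext a b
  have h : ContDiff ℝ ∞ (entry F a b) := hF a b
  have hd : Differentiable ℝ (fderiv ℝ (entry F a b)) :=
    (h.fderiv_right (m := ∞) (by simp)).differentiable (by simp)
  have hs : IsSymmSndFDerivAt ℝ (entry F a b) (x, y, t) :=
    h.contDiffAt.isSymmSndFDerivAt
      (by simpa using WithTop.coe_le_coe.2 (le_top : (2 : ℕ∞) ≤ ⊤))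
  change fderiv ℝ (fun p => fderiv ℝ (entry F a b) p w) (x, y, t) v
    = fderiv ℝ (fun p => fderiv ℝ (entry F a b) p v) (x, y, t) w
  rw [fderiv_clm_apply (hd _) (differentiableAt_const _),
    fderiv_clm_apply (hd _) (differentiableAt_const _)]
  simpa using hs v w

theorem dir_add_left (F : MatField n) (v w : ℝ × ℝ × ℝ) :
    dir (v + w) F = dir v F + dir w F := by
  funext x y t
  ext a b
  exact map_add (fderiv ℝ (entry F a b) (x, y, t)) v w

theorem dir_sub_left (F : MatField n) (v w : ℝ × ℝ × ℝ) :
    dir (v - w) F = dir v F - dir w F := by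
  funext x y t
  ext a b
  exact map_sub (fderiv ℝ (entry F a b) (x, y, t)) v w

theorem dx_eq_dir {F : MatField n} (hF : Smooth F) : dx F = dir (1, 0, 0) F := by
  funext x y t
  ext a b
  have h1 := (hF.differentiable a b (x, y, t)).hasFDerivAt
  have h2 : HasDerivAt (fun s : ℝ => (s, y, t)) ((1 : ℝ), (0 : ℝ), (0 : ℝ)) x :=
    (hasDerivAt_id x).prodMk (hasDerivAt_const x (y, t))
  exact (HasFDerivAt.comp_hasDerivAt x h1 h2).deriv

theorem dy_eq_dir {F : MatField n} (hF : Smooth F) : dy F = dir (0, 1, 0) F := by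
  funext x y t
  ext a b
  have h1 := (hF.differentiable a b (x, y, t)).hasFDerivAt
  have h2 : HasDerivAt (fun s : ℝ => (x, s, t)) ((0 : ℝ), (1 : ℝ), (0 : ℝ)) y :=
    (hasDerivAt_const y x).prodMk ((hasDerivAt_id y).prodMk (hasDerivAt_const y t))
  exact (HasFDerivAt.comp_hasDerivAt y h1 h2).deriv

theorem dt_eq_dir {F : MatField n} (hF : Smooth F) : dt F = dir (0, 0, 1) F := by
  funext x y t
  ext a b
  have h1 := (hF.differentiable a b (x, y, t)).hasFDerivAt
  have h2 : HasDerivAt (fun s : ℝ => (x, y, s)) ((0 : ℝ), (0 : ℝ), (1 : ℝ)) t :=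
    (hasDerivAt_const t x).prodMk ((hasDerivAt_const t y).prodMk (hasDerivAt_id t))
  exact (HasFDerivAt.comp_hasDerivAt t h1 h2).deriv

end Ward

namespace Ward

variable {n : ℕ}

/-! ### The Lax pair under a Bäcklund transformation -/

/-- If the image of the projection field `π` is spanned by the columns of a solution `Ψ` of
`(z ∂_v - ∂_w) Ψ = (A + κ) Ψ` with `A` skew-Hermitian, then `π` satisfies a Riccati type equation. -/
theorem projection_equation {π Ψ Ξ A : MatField n} {z κ : ℂ} {v w : ℝ × ℝ × ℝ}
    (hπ : Smooth π) (hΨ : Smooth Ψ) (hA : star A = -A) (hidem : π * π = π) (hstar : star π = π)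
    (hfix : π * Ψ = Ψ) (hrange : Ψ * Ξ = π)
    (hlax : z • dir v Ψ - dir w Ψ = A * Ψ + κ • Ψ) :
    dir w π = conj z • (π * dir v π) + z • (dir v π * π) + π * A - A * π := by
  have hderiv : ∀ u, dir u π * π + π * dir u π = dir u π := fun u => by
    rw [← dir_mul hπ hπ, hidem]
  -- Differentiating πΨ = Ψ gives (∂π)Ψ = (1 − π)∂Ψ. The scalar κ disappears because (1 − π)Ψ = 0.
  have h1 : (z • dir v π - dir w π) * Ψ = A * Ψ - π * A * Ψ := by
    have hv : dir v π * Ψ = dir v Ψ - π * dir v Ψ := by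
      rw [eq_sub_iff_add_eq, ← dir_mul hπ hΨ, hfix]
    have hw : dir w π * Ψ = dir w Ψ - π * dir w Ψ := by
      rw [eq_sub_iff_add_eq, ← dir_mul hπ hΨ, hfix]
    have hp : π * (z • dir v Ψ - dir w Ψ) = π * A * Ψ + κ • Ψ := by
      rw [hlax, mul_add, mul_smul_comm, hfix, mul_assoc]
    rw [mul_sub, mul_smul_comm] at hp
    rw [sub_mul, smul_mul_assoc, hv, hw, smul_sub]
    linear_combination (norm := module) hlax - hp
  -- Right multiplication by Ξ replaces Ψ by π. The adjoint of the result, in which z becomes z̄, is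
  -- the other half, and (∂π)π + π∂π = ∂π puts the two halves together.
  have h2 : (z • dir v π - dir w π) * π = A * π - π * A * π := by
    have := congrArg (· * Ξ) h1
    simpa only [sub_mul, mul_assoc, hrange] using this
  have h3 : π * (conj z • dir v π - dir w π) = -(π * A) + π * A * π := by
    have := congrArg star h2
    simp only [star_mul, star_sub, star_smul, hstar, hA, ← dir_star hπ] at this
    rw [← starRingEnd_apply] at this
    rw [this]
    noncomm_ring
  have h4 := hderiv w
  rw [sub_mul, smul_mul_assoc] at h2
  rw [mul_sub, mul_smul_comm] at h3
  linear_combination (norm := module) -h4 - h2 - h3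

/-- The factor `1 + k π` intertwines the operators with potentials `A` and
`A + (z̄ - z) ∂_v π`. -/
theorem simpleFactor_lax {π G A A₀ : MatField n} {z μ : ℂ} {v w : ℝ × ℝ × ℝ} (hμ : μ ≠ conj z)
    (hπ : Smooth π) (hG : Smooth G) (hidem : π * π = π)
    (heq : dir w π = conj z • (π * dir v π) + z • (dir v π * π) + π * A - A * π)
    (hlax : μ • dir v G - dir w G = A * G - G * A₀) :
    μ • dir v ((1 + ((conj z - z) / (μ - conj z)) • π) * G)
        - dir w ((1 + ((conj z - z) / (μ - conj z)) • π) * G)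
      = (A + (conj z - z) • dir v π) * ((1 + ((conj z - z) / (μ - conj z)) • π) * G)
        - ((1 + ((conj z - z) / (μ - conj z)) • π) * G) * A₀ := by
  obtain ⟨k, hk⟩ : ∃ k, k = (conj z - z) / (μ - conj z) := ⟨_, rfl⟩
  have hz : conj z - z = k * (μ - conj z) := by
    rw [hk, div_mul_cancel₀ _ (sub_ne_zero.2 hμ)]
  rw [← hk]
  have hs := smooth_one.add (hπ.const_smul k)
  have hd : ∀ u, dir u (1 + k • π) = k • dir u π := fun u => by
    rw [dir_add smooth_one (hπ.const_smul k), dir_one, dir_const_smul _ hπ, zero_add]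
  rw [dir_mul hs hG, dir_mul hs hG, hd, hd, hz]
  have hderiv : dir v π * π + π * dir v π = dir v π := by
    rw [← dir_mul hπ hπ, hidem]
  -- The intertwining relation for the factor alone. Multiplied by G on the right, it combines with
  -- the equation of G.
  have hmain : k • (μ • dir v π - dir w π) + (1 + k • π) * A
      = (A + (k * (μ - conj z)) • dir v π) * (1 + k • π) := by
    have hz' : z = conj z - k * (μ - conj z) := by rw [← hz]; ring
    rw [heq]
    simp only [mul_add, add_mul, mul_one, one_mul, smul_mul_assoc, mul_smul_comm]
    generalize conj z = zb at *
    subst hz'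
    linear_combination (norm := module) -(k * zb) • hderiv
  have hmul := congrArg (· * G) hmain
  have hl := congrArg (fun F => (1 + k • π) * F) hlax
  simp only [mul_add, add_mul, mul_sub, sub_mul, mul_one, one_mul, smul_mul_assoc, mul_smul_comm,
    mul_assoc, smul_add, smul_sub] at hmul hl ⊢
  linear_combination (norm := module) hmul + hl

/-- The logarithmic derivative of `J` changes by `(z̄ - z) ∂_v π` under `J ↦ J (1 + (z̄/z - 1) π)`. -/
theorem map_lax {π J A : MatField n} {z : ℂ} {v w : ℝ × ℝ × ℝ} (hz : z ≠ 0)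
    (hπ : Smooth π) (hJ : Smooth J) (hidem : π * π = π)
    (heq : dir w π = conj z • (π * dir v π) + z • (dir v π * π) + π * A - A * π)
    (hlax : dir w J = J * A) :
    dir w (J * (1 + (conj z / z - 1) • π))
      = J * (1 + (conj z / z - 1) • π) * (A + (conj z - z) • dir v π) := by
  obtain ⟨k, hk⟩ : ∃ k, k = conj z / z - 1 := ⟨_, rfl⟩
  have hkz : conj z = k * z + z := by rw [hk]; field_simp; ring
  rw [← hk]
  have hs := smooth_one.add (hπ.const_smul k)
  have hd : ∀ u, dir u (1 + k • π) = k • dir u π := fun u => by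
    rw [dir_add smooth_one (hπ.const_smul k), dir_one, dir_const_smul _ hπ, zero_add]
  rw [dir_mul hJ hs, hd, hlax, mul_assoc, mul_assoc, ← mul_add]
  congr 1
  have hderiv : dir v π * π + π * dir v π = dir v π := by
    rw [← dir_mul hπ hπ, hidem]
  rw [heq]
  generalize conj z = zb at *
  subst hkz
  simp only [mul_add, add_mul, mul_one, one_mul, smul_mul_assoc, mul_smul_comm]
  linear_combination (norm := module) (k * z) • hderiv

end Ward

namespace Ward

/-! ### Projections onto complex lines -/

/-- The squared norm of the first column. -/
def colNormSq (Ψ : Matrix (Fin 2) (Fin 2) ℂ) : ℂ :=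
  Ψ 0 0 * conj (Ψ 0 0) + Ψ 1 0 * conj (Ψ 1 0)

/-- The Hermitian projection onto the first column of a matrix whose second column vanishes. -/
noncomputable def lineProj (Ψ : Matrix (Fin 2) (Fin 2) ℂ) : Matrix (Fin 2) (Fin 2) ℂ :=
  (colNormSq Ψ)⁻¹ • (Ψ * Ψᴴ)

/-- The matrix with first column `(1, q)ᵀ` and vanishing second column. -/
def seedCol (q : ℂ) : Matrix (Fin 2) (Fin 2) ℂ := !![1, 0; q, 0]

theorem colNormSq_eq_ofReal (Ψ : Matrix (Fin 2) (Fin 2) ℂ) :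
    colNormSq Ψ = ((‖Ψ 0 0‖ ^ 2 + ‖Ψ 1 0‖ ^ 2 : ℝ) : ℂ) := by
  simp [colNormSq, Complex.mul_conj, Complex.normSq_eq_norm_sq]

theorem conj_colNormSq (Ψ : Matrix (Fin 2) (Fin 2) ℂ) : conj (colNormSq Ψ) = colNormSq Ψ := by
  rw [colNormSq_eq_ofReal, Complex.conj_ofReal]

/-- An invertible matrix cannot annihilate (1, q)ᵀ. -/
theorem colNormSq_ne_zero {G : Matrix (Fin 2) (Fin 2) ℂ} (hG : G.det ≠ 0) (q : ℂ) :
    colNormSq (G * seedCol q) ≠ 0 := by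
  rw [colNormSq_eq_ofReal]
  intro h
  have h' : ‖(G * seedCol q) 0 0‖ ^ 2 + ‖(G * seedCol q) 1 0‖ ^ 2 = 0 := by exact_mod_cast h
  have h0 : (G * seedCol q) 0 0 = 0 := by
    rw [← norm_eq_zero]
    nlinarith [sq_nonneg ‖(G * seedCol q) 0 0‖, sq_nonneg ‖(G * seedCol q) 1 0‖]
  have h1 : (G * seedCol q) 1 0 = 0 := by
    rw [← norm_eq_zero]
    nlinarith [sq_nonneg ‖(G * seedCol q) 0 0‖, sq_nonneg ‖(G * seedCol q) 1 0‖]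
  simp [seedCol, Matrix.mul_apply, Fin.sum_univ_two] at h0 h1
  apply hG
  rw [Matrix.det_fin_two]
  linear_combination G 1 1 * h0 - G 0 1 * h1

theorem mul_seedCol_col (G : Matrix (Fin 2) (Fin 2) ℂ) (q : ℂ) (a : Fin 2) :
    (G * seedCol q) a 1 = 0 := by
  simp [seedCol, Matrix.mul_apply, Fin.sum_univ_two]

theorem lineProj_apply {Ψ : Matrix (Fin 2) (Fin 2) ℂ} (hΨ : ∀ a, Ψ a 1 = 0) (a b : Fin 2) :
    lineProj Ψ a b = (colNormSq Ψ)⁻¹ * (Ψ a 0 * conj (Ψ b 0)) := by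
  simp [lineProj, Matrix.mul_apply, Fin.sum_univ_two, hΨ]

theorem lineProj_mul_self {Ψ : Matrix (Fin 2) (Fin 2) ℂ} (hΨ : ∀ a, Ψ a 1 = 0)
    (h0 : colNormSq Ψ ≠ 0) : lineProj Ψ * Ψ = Ψ := by
  ext a b
  fin_cases b
  · simp only [Matrix.mul_apply, Fin.sum_univ_two, lineProj_apply hΨ]
    field_simp
    simp [colNormSq]
    ring
  · simp [Matrix.mul_apply, hΨ]

theorem lineProj_idem {Ψ : Matrix (Fin 2) (Fin 2) ℂ} (hΨ : ∀ a, Ψ a 1 = 0)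
    (h0 : colNormSq Ψ ≠ 0) : lineProj Ψ * lineProj Ψ = lineProj Ψ := by
  nth_rw 2 [lineProj]
  rw [Matrix.mul_smul, ← Matrix.mul_assoc, lineProj_mul_self hΨ h0, ← lineProj]

theorem lineProj_conjTranspose (Ψ : Matrix (Fin 2) (Fin 2) ℂ) : (lineProj Ψ)ᴴ = lineProj Ψ := by
  rw [lineProj, Matrix.conjTranspose_smul, Matrix.conjTranspose_mul,
    Matrix.conjTranspose_conjTranspose, star_inv₀, ← starRingEnd_apply, conj_colNormSq]

theorem det_one_add_smul_lineProj {Ψ : Matrix (Fin 2) (Fin 2) ℂ} (hΨ : ∀ a, Ψ a 1 = 0)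
    (h0 : colNormSq Ψ ≠ 0) (k : ℂ) : (1 + k • lineProj Ψ).det = 1 + k := by
  rw [Matrix.det_fin_two]
  simp only [Matrix.add_apply, Matrix.smul_apply, lineProj_apply hΨ, smul_eq_mul]
  simp
  field_simp
  simp [colNormSq]
  ring

/-- A line does not depend on the scale of its spanning vector. This removes the exponential
prefactor of ψ₀ and later lets q be divided out of (1, q)ᵀ. -/
theorem lineProj_smul {c : ℂ} (hc : c ≠ 0) (Ψ : Matrix (Fin 2) (Fin 2) ℂ) :
    lineProj (c • Ψ) = lineProj Ψ := by
  have hn : colNormSq (c • Ψ) = (c * conj c) * colNormSq Ψ := by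
    simp [colNormSq]
    ring
  have hcc : c * conj c ≠ 0 := mul_ne_zero hc ((map_ne_zero _).2 hc)
  rw [lineProj, hn, Matrix.conjTranspose_smul, Matrix.smul_mul, Matrix.mul_smul, smul_smul,
    smul_smul, lineProj]
  congr 1
  have hc' : conj c ≠ 0 := (map_ne_zero _).2 hc
  rw [← starRingEnd_apply, mul_inv]
  field_simp

/-- Replaces the abstract orthogonal projection by a formula rational in the vector and its
conjugate, from which smoothness and asymptotics can be read off. -/
theorem hermProj_span (v : Fin 2 → ℂ) :
    hermProj (Submodule.span ℂ {WithLp.toLp 2 v}) = lineProj !![v 0, 0; v 1, 0] := by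
  ext a b
  rw [lineProj_apply (by intro a; fin_cases a <;> rfl)]
  have h : hermProj (Submodule.span ℂ {WithLp.toLp 2 v}) a b
      = ((Submodule.span ℂ {WithLp.toLp 2 v}).starProjection (EuclideanSpace.single b 1)) a := by
    have := congrArg (fun L => L (EuclideanSpace.single b 1) a)
      (Matrix.toEuclideanLin.apply_symm_apply
        ((Submodule.span ℂ {WithLp.toLp 2 v}).starProjection :
          EuclideanSpace ℂ (Fin 2) →ₗ[ℂ] EuclideanSpace ℂ (Fin 2)))
    rw [ContinuousLinearMap.coe_coe] at this
    rw [← this]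
    change hermProj _ a b = (hermProj _ *ᵥ (EuclideanSpace.single b (1 : ℂ)).ofLp) a
    rw [PiLp.ofLp_single, Matrix.mulVec_single_one]
    rfl
  rw [h, Submodule.starProjection_singleton]
  have hn : colNormSq !![v 0, 0; v 1, 0] = ((‖WithLp.toLp 2 v‖ ^ 2 : ℝ) : ℂ) := by
    rw [colNormSq_eq_ofReal, EuclideanSpace.norm_sq_eq]
    simp [Fin.sum_univ_two]
  rw [hn]
  have hcol : ∀ c : Fin 2, (!![v 0, 0; v 1, 0] : Matrix (Fin 2) (Fin 2) ℂ) c 0 = v c := by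
    intro c; fin_cases c <;> rfl
  rw [hcol, hcol]
  simp [EuclideanSpace.inner_single_right]
  ring

theorem map_range_hermProj (M : Matrix (Fin 2) (Fin 2) ℂ) (v : Fin 2 → ℂ) :
    Submodule.map (Matrix.toEuclideanLin M)
        (LinearMap.range (Matrix.toEuclideanLin (hermProj (Submodule.span ℂ {WithLp.toLp 2 v}))))
      = Submodule.span ℂ {WithLp.toLp 2 (M *ᵥ v)} := by
  rw [hermProj, LinearEquiv.apply_symm_apply, Submodule.range_starProjection,
    Submodule.map_span, Set.image_singleton]
  rfl

/-! ### Dressing -/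

/-- Successive products of simple factors with poles `z 1, …, z s`, the `r`-th projection being
onto the image of `(1, q r)ᵀ` under the preceding product evaluated at `z r`. -/
noncomputable def dressing (z : ℕ → ℂ) (q : ℕ → ℝ → ℝ → ℝ → ℂ) : ℕ → ℂ → MatField 2
  | 0, _ => 1
  | s + 1, μ =>
    (1 + ((conj (z (s + 1)) - z (s + 1)) / (μ - conj (z (s + 1)))) •
      (fun x y t => lineProj (dressing z q s (z (s + 1)) x y t * seedCol (q (s + 1) x y t)) :
        MatField 2)) * dressing z q s μ

/-- The matrix field spanning the image of the projection in the `s + 1`-st factor. -/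
noncomputable def dressCol (z : ℕ → ℂ) (q : ℕ → ℝ → ℝ → ℝ → ℂ) (s : ℕ) : MatField 2 :=
  dressing z q s (z (s + 1)) * fun x y t => seedCol (q (s + 1) x y t)

/-- The projection in the `s + 1`-st factor. -/
noncomputable def dressProj (z : ℕ → ℂ) (q : ℕ → ℝ → ℝ → ℝ → ℂ) (s : ℕ) : MatField 2 :=
  fun x y t => lineProj (dressCol z q s x y t)

/-- `∏ (μ - z r) / (μ - conj (z r))` over `1 ≤ r ≤ s`. -/
noncomputable def blaschke (z : ℕ → ℂ) (s : ℕ) (μ : ℂ) : ℂ :=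
  ∏ r ∈ Finset.range s, (μ - z (r + 1)) / (μ - conj (z (r + 1)))

/-- The poles `z 1, …, z M` are pairwise distinct, and none is conjugate to another or to itself. -/
structure AdmissiblePoles (z : ℕ → ℂ) (M : ℕ) : Prop where
  ne_conj : ∀ r < M, ∀ s < M, z (r + 1) ≠ conj (z (s + 1))
  ne : ∀ r < M, ∀ s < M, r ≠ s → z (r + 1) ≠ z (s + 1)

theorem AdmissiblePoles.ne_zero {z : ℕ → ℂ} {M : ℕ} (h : AdmissiblePoles z M) {r : ℕ}
    (hr : r < M) : z (r + 1) ≠ 0 := fun h0 => h.ne_conj r hr r hr (by simp [h0])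

variable {z : ℕ → ℂ} {q : ℕ → ℝ → ℝ → ℝ → ℂ} {M : ℕ}

theorem dressing_zero (μ : ℂ) : dressing z q 0 μ = 1 := rfl

theorem dressing_succ (s : ℕ) (μ : ℂ) : dressing z q (s + 1) μ =
    (1 + ((conj (z (s + 1)) - z (s + 1)) / (μ - conj (z (s + 1)))) • dressProj z q s)
      * dressing z q s μ := rfl

theorem blaschke_succ (s : ℕ) (μ : ℂ) : blaschke z (s + 1) μ
    = blaschke z s μ * ((μ - z (s + 1)) / (μ - conj (z (s + 1)))) :=
  Finset.prod_range_succ _ _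

theorem blaschke_ne_zero {s : ℕ} {μ : ℂ} (h : ∀ r < s, μ ≠ z (r + 1))
    (h' : ∀ r < s, μ ≠ conj (z (r + 1))) : blaschke z s μ ≠ 0 :=
  Finset.prod_ne_zero_iff.2 fun r hr => div_ne_zero
    (sub_ne_zero.2 (h r (Finset.mem_range.1 hr))) (sub_ne_zero.2 (h' r (Finset.mem_range.1 hr)))

theorem AdmissiblePoles.blaschke_ne_zero (hz : AdmissiblePoles z M) {s : ℕ} (hs : s < M) :
    blaschke z s (z (s + 1)) ≠ 0 :=
  Ward.blaschke_ne_zero (fun r hr => hz.ne s hs r (hr.trans hs) hr.ne')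
    fun r hr => hz.ne_conj s hs r (hr.trans hs)

theorem dressCol_col (s : ℕ) (x y t : ℝ) (a : Fin 2) : dressCol z q s x y t a 1 = 0 :=
  mul_seedCol_col _ _ a

/-- A factor contributes (μ − z)/(μ − z̄), provided that its line is spanned by a nonzero vector.
That in turn needs the determinant of the preceding product at the next pole, so the induction is
uniform in μ. -/
theorem det_dressing (hz : AdmissiblePoles z M) {s : ℕ} (hs : s ≤ M) {μ : ℂ}
    (hμ : ∀ r < s, μ ≠ conj (z (r + 1))) (x y t : ℝ) :
    (dressing z q s μ x y t).det = blaschke z s μ := by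
  induction s generalizing μ with
  | zero => simp [dressing_zero, blaschke]
  | succ s ih =>
    have hne : (dressing z q s (z (s + 1)) x y t).det ≠ 0 := by
      rw [ih (Nat.le_of_succ_le hs) fun r hr => hz.ne_conj s hs r (hr.trans hs)]
      exact hz.blaschke_ne_zero hs
    have h1 := sub_ne_zero.2 (hμ s (Nat.lt_succ_self s))
    rw [dressing_succ, Pi.mul_apply, Pi.mul_apply, Pi.mul_apply, Matrix.det_mul,
      ih (Nat.le_of_succ_le hs) fun r hr => hμ r (hr.trans (Nat.lt_succ_self s)), blaschke_succ]
    have := det_one_add_smul_lineProj (dressCol_col (z := z) (q := q) s x y t)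
      (colNormSq_ne_zero hne _) ((conj (z (s + 1)) - z (s + 1)) / (μ - conj (z (s + 1))))
    rw [mul_comm]
    congr 1
    refine this.trans ?_
    field_simp
    ring

theorem colNormSq_dressCol_ne_zero (hz : AdmissiblePoles z M) {s : ℕ} (hs : s < M) (x y t : ℝ) :
    colNormSq (dressCol z q s x y t) ≠ 0 := by
  refine colNormSq_ne_zero ?_ _
  rw [det_dressing hz hs.le fun r hr => hz.ne_conj s hs r (hr.trans hs)]
  exact hz.blaschke_ne_zero hs

theorem dressProj_idem (hz : AdmissiblePoles z M) {s : ℕ} (hs : s < M) :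
    dressProj z q s * dressProj z q s = dressProj z q s := by
  funext x y t
  exact lineProj_idem (dressCol_col s x y t) (colNormSq_dressCol_ne_zero hz hs x y t)

theorem star_dressProj (s : ℕ) : star (dressProj z q s) = dressProj z q s := by
  funext x y t
  exact lineProj_conjTranspose _

theorem dressProj_mul_dressCol (hz : AdmissiblePoles z M) {s : ℕ} (hs : s < M) :
    dressProj z q s * dressCol z q s = dressCol z q s := by
  funext x y t
  exact lineProj_mul_self (dressCol_col s x y t) (colNormSq_dressCol_ne_zero hz hs x y t)

/-- Supplies the hypothesis `hrange` of `projection_equation`. -/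
theorem exists_dressCol_mul_eq (s : ℕ) : ∃ Ξ, dressCol z q s * Ξ = dressProj z q s := by
  refine ⟨fun x y t => (colNormSq (dressCol z q s x y t))⁻¹ • (dressCol z q s x y t)ᴴ, ?_⟩
  funext x y t
  exact Matrix.mul_smul _ _ _

/-! ### Smoothness and periodicity of the dressing. -/

theorem smooth_seedCol {f : ℝ → ℝ → ℝ → ℂ}
    (hf : ContDiff ℝ ∞ fun p : ℝ × ℝ × ℝ => f p.1 p.2.1 p.2.2) :
    Smooth (fun x y t => seedCol (f x y t)) := by
  intro a b
  fin_cases a <;> fin_cases b <;> simp [seedCol, contDiff_const, hf]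

theorem smooth_lineProj {Ψ : MatField 2} (hΨ : Smooth Ψ) (h0 : ∀ x y t, colNormSq (Ψ x y t) ≠ 0) :
    Smooth (fun x y t => lineProj (Ψ x y t)) := by
  intro a b
  have hn : ContDiff ℝ ∞ fun p : ℝ × ℝ × ℝ => colNormSq (Ψ p.1 p.2.1 p.2.2) :=
    ((hΨ 0 0).mul (Complex.conjCLE.contDiff.comp (hΨ 0 0))).add
      ((hΨ 1 0).mul (Complex.conjCLE.contDiff.comp (hΨ 1 0)))
  exact (hn.inv fun p => h0 _ _ _).mul ((hΨ.mul hΨ.star) a b)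

theorem smooth_dressing (hz : AdmissiblePoles z M)
    (hq : ∀ s < M, ContDiff ℝ ∞ fun p : ℝ × ℝ × ℝ => q (s + 1) p.1 p.2.1 p.2.2) {s : ℕ}
    (hs : s ≤ M) (μ : ℂ) : Smooth (dressing z q s μ) := by
  induction s generalizing μ with
  | zero => exact smooth_one
  | succ s ih =>
    have ih' := ih (Nat.le_of_succ_le hs)
    have hp : Smooth (dressProj z q s) :=
      smooth_lineProj ((ih' _).mul (smooth_seedCol (hq s hs)))
        (colNormSq_dressCol_ne_zero hz hs)
    exact (smooth_one.add (hp.const_smul _)).mul (ih' μ)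

theorem smooth_dressCol (hz : AdmissiblePoles z M)
    (hq : ∀ s < M, ContDiff ℝ ∞ fun p : ℝ × ℝ × ℝ => q (s + 1) p.1 p.2.1 p.2.2) {s : ℕ}
    (hs : s < M) : Smooth (dressCol z q s) :=
  (smooth_dressing hz hq hs.le _).mul (smooth_seedCol (hq s hs))

theorem smooth_dressProj (hz : AdmissiblePoles z M)
    (hq : ∀ s < M, ContDiff ℝ ∞ fun p : ℝ × ℝ × ℝ => q (s + 1) p.1 p.2.1 p.2.2) {s : ℕ}
    (hs : s < M) : Smooth (dressProj z q s) :=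
  smooth_lineProj (smooth_dressCol hz hq hs) (colNormSq_dressCol_ne_zero hz hs)

theorem dressing_periodic (hq : ∀ s < M, ∀ x y t,
      q (s + 1) (x + 2 * Real.pi) y t = q (s + 1) x y t ∧
      q (s + 1) x (y + 2 * Real.pi) t = q (s + 1) x y t) {s : ℕ} (hs : s ≤ M) (μ : ℂ) :
    DoublyPeriodic (dressing z q s μ) := by
  induction s generalizing μ with
  | zero => exact fun _ _ _ => ⟨rfl, rfl⟩
  | succ s ih =>
    intro x y t
    have h1 := ih (Nat.le_of_succ_le hs) μ x y t
    have h2 := ih (Nat.le_of_succ_le hs) (z (s + 1)) x y t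
    have h3 := hq s hs x y t
    simp only [dressing_succ, Pi.mul_apply, Pi.add_apply, Pi.smul_apply, dressProj, dressCol, h1,
      h2, h3, Pi.one_apply, and_self]

theorem dressProj_periodic (hq : ∀ s < M, ∀ x y t,
      q (s + 1) (x + 2 * Real.pi) y t = q (s + 1) x y t ∧
      q (s + 1) x (y + 2 * Real.pi) t = q (s + 1) x y t) {s : ℕ} (hs : s < M) :
    DoublyPeriodic (dressProj z q s) := by
  intro x y t
  have h2 := dressing_periodic (z := z) hq hs.le (z (s + 1)) x y t
  have h3 := hq s hs x y t
  simp only [Pi.mul_apply, dressProj, dressCol, h2, h3, and_self]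

end Ward

namespace Ward

/-! ### Dressing produces Ward maps -/

/-- The map obtained from `J` by multiplying successively with the unimodular normalizations of
the inverse simple factors at `0`. -/
noncomputable def dressMap (z : ℕ → ℂ) (q : ℕ → ℝ → ℝ → ℝ → ℂ) (J : MatField 2) : ℕ → MatField 2
  | 0 => J
  | s + 1 => (z (s + 1) / (‖z (s + 1)‖ : ℂ)) •
      (dressMap z q J s * (1 + (conj (z (s + 1)) / z (s + 1) - 1) • dressProj z q s))

variable {z : ℕ → ℂ} {q : ℕ → ℝ → ℝ → ℝ → ℂ} {M : ℕ} {J : MatField 2}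

theorem dressMap_succ (s : ℕ) : dressMap z q J (s + 1) = (z (s + 1) / (‖z (s + 1)‖ : ℂ)) •
    (dressMap z q J s * (1 + (conj (z (s + 1)) / z (s + 1) - 1) • dressProj z q s)) := rfl

theorem smooth_dressMap (hz : AdmissiblePoles z M)
    (hq : ∀ s < M, ContDiff ℝ ∞ fun p : ℝ × ℝ × ℝ => q (s + 1) p.1 p.2.1 p.2.2)
    (hJ : Smooth J) {s : ℕ} (hs : s ≤ M) : Smooth (dressMap z q J s) := by
  induction s with
  | zero => exact hJ
  | succ s ih =>
    exact ((ih (Nat.le_of_succ_le hs)).mul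
      (smooth_one.add ((smooth_dressProj hz hq hs).const_smul _))).const_smul _

theorem dressMap_periodic (hq : ∀ s < M, ∀ x y t,
      q (s + 1) (x + 2 * Real.pi) y t = q (s + 1) x y t ∧
      q (s + 1) x (y + 2 * Real.pi) t = q (s + 1) x y t)
    (hJ : DoublyPeriodic J) {s : ℕ} (hs : s ≤ M) : DoublyPeriodic (dressMap z q J s) := by
  induction s with
  | zero => exact hJ
  | succ s ih =>
    intro x y t
    have h1 := ih (Nat.le_of_succ_le hs) x y t
    have h2 := dressProj_periodic (z := z) hq hs x y t
    simp only [dressMap_succ, Pi.mul_apply, Pi.add_apply, Pi.smul_apply, Pi.one_apply, h1, h2,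
      and_self]

/-- The new factor of the map sits next to the new factor of the dressing at 0, and the two cancel
up to a unimodular constant. This is the only link needed between J and G in the asymptotic
analysis. -/
theorem dressMap_mul_dressing (hz : AdmissiblePoles z M) {s : ℕ} (hs : s ≤ M) :
    dressMap z q J s * dressing z q s 0
      = (∏ r ∈ Finset.range s, z (r + 1) / (‖z (r + 1)‖ : ℂ)) • J := by
  induction s with
  | zero => simp [dressMap, dressing_zero]
  | succ s ih =>
    have h0 := hz.ne_zero hs
    have h0' : conj (z (s + 1)) ≠ 0 := (map_ne_zero _).2 h0
    -- At μ = 0 the coefficients of the projection are z̄/z − 1 and z/z̄ − 1, so the eigenvalues on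
    -- the line are inverse to each other.
    have hk : (1 + (conj (z (s + 1)) / z (s + 1) - 1) • dressProj z q s)
        * (1 + ((conj (z (s + 1)) - z (s + 1)) / (0 - conj (z (s + 1)))) • dressProj z q s)
        = 1 := by
      simp only [mul_add, add_mul, mul_one, one_mul, smul_mul_assoc, mul_smul_comm,
        dressProj_idem hz hs]
      match_scalars
      · ring
      · field_simp
        ring
    rw [dressMap_succ, dressing_succ, smul_mul_assoc, mul_assoc, ← mul_assoc _ _ (dressing z q s 0),
      hk, one_mul, ih (Nat.le_of_succ_le hs), smul_smul, Finset.prod_range_succ, mul_comm]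

/-- On the line the factor is multiplication by z̄/|z|, on its complement by z/|z|: two conjugate
unimodular eigenvalues. -/
theorem dressMap_mem_SU (hz : AdmissiblePoles z M)
    (hJ : ∀ x y t, J x y t ∈ Matrix.specialUnitaryGroup (Fin 2) ℂ) {s : ℕ} (hs : s ≤ M)
    (x y t : ℝ) : dressMap z q J s x y t ∈ Matrix.specialUnitaryGroup (Fin 2) ℂ := by
  induction s with
  | zero => exact hJ x y t
  | succ s ih =>
    have h0 := hz.ne_zero hs
    have h0' : conj (z (s + 1)) ≠ 0 := (map_ne_zero _).2 h0
    have hn : (‖z (s + 1)‖ : ℂ) ≠ 0 := by simpa using h0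
    have hzz : z (s + 1) * conj (z (s + 1)) = (‖z (s + 1)‖ : ℂ) ^ 2 := by
      rw [Complex.mul_conj, Complex.normSq_eq_norm_sq]
      push_cast
      rfl
    have hc := dressCol_col (z := z) (q := q) s x y t
    have hd := colNormSq_dressCol_ne_zero (q := q) hz hs x y t
    have hi : dressProj z q s x y t * dressProj z q s x y t = dressProj z q s x y t :=
      lineProj_idem hc hd
    have hst : (dressProj z q s x y t)ᴴ = dressProj z q s x y t := lineProj_conjTranspose _
    have hmem : (z (s + 1) / (‖z (s + 1)‖ : ℂ)) •
        (1 + (conj (z (s + 1)) / z (s + 1) - 1) • dressProj z q s x y t)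
        ∈ Matrix.specialUnitaryGroup (Fin 2) ℂ := by
      rw [Matrix.mem_specialUnitaryGroup_iff, Matrix.mem_unitaryGroup_iff]
      constructor
      · rw [Matrix.star_eq_conjTranspose, Matrix.conjTranspose_smul, Matrix.conjTranspose_add,
          Matrix.conjTranspose_smul, hst, Matrix.conjTranspose_one]
        simp only [mul_add, add_mul, mul_one, one_mul, smul_mul_assoc, mul_smul_comm, hi,
          ← starRingEnd_apply, map_div₀, map_sub, map_one, Complex.conj_conj, Complex.conj_ofReal]
        match_scalars
        · field_simp
          linear_combination hzz
        · field_simp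
          ring
      · have hdet := det_one_add_smul_lineProj hc hd (conj (z (s + 1)) / z (s + 1) - 1)
        rw [← dressProj] at hdet
        rw [Matrix.det_smul, hdet, Fintype.card_fin]
        field_simp
        linear_combination hzz
    have := mul_mem (ih (Nat.le_of_succ_le hs)) hmem
    rwa [Matrix.mul_smul] at this

/-- The direction of `∂_x`. -/
def dirX : ℝ × ℝ × ℝ := (1, 0, 0)

/-- The direction of `∂_u = ∂_t + ∂_y`. -/
def dirU : ℝ × ℝ × ℝ := (0, 1, 1)

/-- The direction of `∂_v = ∂_t - ∂_y`. -/
def dirV : ℝ × ℝ × ℝ := (0, -1, 1)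

/-- With R = J⁻¹J_t and Q = J⁻¹J_y one has A = R + Q, so ∂_v A = R_t − Q_y + (Q_t − R_y). Flatness
of J⁻¹dJ turns the bracket into −[R, Q], and ∂_v A = ∂_x B becomes the Ward equation. -/
theorem wardOp_eq_zero {A B : MatField 2} (hJ : Smooth J) (hB : Smooth B)
    (hdet : ∀ x y t, IsUnit (J x y t).det) (hJU : dir dirU J = J * A) (hJX : dir dirX J = J * B)
    (hAB : dir dirV A = dir dirX B) : wardOp J = 0 := by
  obtain ⟨R, hR⟩ : ∃ R, R = invMul J (dt J) := ⟨_, rfl⟩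
  obtain ⟨Q, hQ⟩ : ∃ Q, Q = invMul J (dy J) := ⟨_, rfl⟩
  have hinv : ∀ F : MatField 2, invMul J (J * F) = F := fun F => by
    funext x y t
    exact Matrix.nonsing_inv_mul_cancel_left _ _ (hdet x y t)
  have hinv' : ∀ F : MatField 2, J * invMul J F = F := fun F => by
    funext x y t
    exact Matrix.mul_nonsing_inv_cancel_left _ _ (hdet x y t)
  have hcancel : ∀ F G : MatField 2, J * F = J * G → F = G := fun F G h => by
    rw [← hinv F, h, hinv]
  have hU : dirU = (0, 0, 1) + (0, 1, 0) := by simp [dirU]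
  have hV : dirV = (0, 0, 1) - (0, 1, 0) := by simp [dirV]
  have hP : invMul J (dx J) = B := by
    rw [dx_eq_dir hJ]
    change invMul J (dir dirX J) = B
    rw [hJX, hinv]
  have hJR : J * R = dir (0, 0, 1) J := by rw [hR, hinv', dt_eq_dir hJ]
  have hJQ : J * Q = dir (0, 1, 0) J := by rw [hQ, hinv', dy_eq_dir hJ]
  have hRQ : R + Q = A := by
    apply hcancel
    rw [mul_add, hJR, hJQ, ← hJU, hU, dir_add_left]
  have hinvsm : ∀ F : MatField 2, Smooth F → Smooth (invMul J F) := by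
    intro F hF
    have hd : ContDiff ℝ ∞ fun p : ℝ × ℝ × ℝ => (J p.1 p.2.1 p.2.2).det := by
      simp only [Matrix.det_fin_two]
      exact ((hJ 0 0).mul (hJ 1 1)).sub ((hJ 0 1).mul (hJ 1 0))
    have hi := hd.inv fun p => (hdet _ _ _).ne_zero
    have : Smooth (fun x y t => (J x y t)⁻¹) := by
      intro a b
      simp only [Matrix.inv_def, Matrix.adjugate_fin_two, Ring.inverse_eq_inv']
      fin_cases a <;> fin_cases b
      · exact hi.mul (hJ 1 1)
      · exact hi.mul (hJ 0 1).neg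
      · exact hi.mul (hJ 1 0).neg
      · exact hi.mul (hJ 0 0)
    exact this.mul hF
  have hRs : Smooth R := by
    rw [hR, dt_eq_dir hJ]
    exact hinvsm _ (hJ.dir _)
  have hQs : Smooth Q := by
    rw [hQ, dy_eq_dir hJ]
    exact hinvsm _ (hJ.dir _)
  -- Equality of the mixed derivatives J_ty = J_yt, with J cancelled on the left.
  have hflat : dir (0, 0, 1) Q + R * Q = dir (0, 1, 0) R + Q * R := by
    apply hcancel
    have h1 := congrArg (dir (0, 0, 1)) hJQ
    have h2 := congrArg (dir (0, 1, 0)) hJR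
    rw [dir_mul hJ hQs, ← hJR] at h1
    rw [dir_mul hJ hRs, ← hJQ] at h2
    rw [dir_comm hJ, ← h2] at h1
    rw [mul_add, mul_add, ← mul_assoc, ← mul_assoc, add_comm, h1, add_comm]
  have hcomm : comm R Q = R * Q - Q * R := rfl
  rw [wardOp, hP, ← hR, ← hQ, dt_eq_dir hRs, dx_eq_dir hB, dy_eq_dir hQs, hcomm]
  rw [← hRQ, hV, dir_sub_left, dir_add hRs hQs, dir_add hRs hQs, dirX] at hAB
  rw [← hAB]
  have := sub_eq_zero.2 hflat
  rw [← neg_eq_zero]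
  refine Eq.trans ?_ this
  abel

/-- The Lax pair of the dressed objects. -/
theorem exists_lax_dressing (hz : AdmissiblePoles z M)
    (hq : ∀ s < M, ContDiff ℝ ∞ fun p : ℝ × ℝ × ℝ => q (s + 1) p.1 p.2.1 p.2.2)
    (hJ : Smooth J) {A₀ : MatField 2} {κ : ℂ} (hA₀ : Smooth A₀) (hA₀star : star A₀ = -A₀)
    (hA₀dir : ∀ v, dir v A₀ = 0) (hJU : dir dirU J = J * A₀) (hJX : dir dirX J = J * A₀)
    (hqU : ∀ s < M, z (s + 1) • dir dirX (fun x y t => seedCol (q (s + 1) x y t))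
        - dir dirU (fun x y t => seedCol (q (s + 1) x y t))
      = A₀ * (fun x y t => seedCol (q (s + 1) x y t))
        + κ • (fun x y t => seedCol (q (s + 1) x y t)))
    (hqV : ∀ s < M, z (s + 1) • dir dirV (fun x y t => seedCol (q (s + 1) x y t))
        - dir dirX (fun x y t => seedCol (q (s + 1) x y t))
      = A₀ * (fun x y t => seedCol (q (s + 1) x y t))
        + κ • (fun x y t => seedCol (q (s + 1) x y t)))
    {s : ℕ} (hs : s ≤ M) :
    ∃ A B : MatField 2, Smooth A ∧ Smooth B ∧ star A = -A ∧ star B = -B ∧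
      dir dirV A = dir dirX B ∧
      dir dirU (dressMap z q J s) = dressMap z q J s * A ∧
      dir dirX (dressMap z q J s) = dressMap z q J s * B ∧
      ∀ μ, (∀ r < s, μ ≠ conj (z (r + 1))) →
        μ • dir dirX (dressing z q s μ) - dir dirU (dressing z q s μ)
            = A * dressing z q s μ - dressing z q s μ * A₀ ∧
          μ • dir dirV (dressing z q s μ) - dir dirX (dressing z q s μ)
            = B * dressing z q s μ - dressing z q s μ * A₀ := by
  induction s with
  | zero =>
    refine ⟨A₀, A₀, hA₀, hA₀, hA₀star, hA₀star, by rw [hA₀dir, hA₀dir], hJU, hJX, fun μ _ => ?_⟩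
    simp [dressing_zero, dir_one]
  | succ s ih =>
    obtain ⟨A, B, hA, hB, hAs, hBs, hAB, hU, hX, hlax⟩ := ih (Nat.le_of_succ_le hs)
    have hsm := smooth_dressing hz hq (Nat.le_of_succ_le hs)
    have hJs := smooth_dressMap hz hq hJ (Nat.le_of_succ_le hs)
    have hΨ := smooth_dressCol hz hq hs
    have hπ := smooth_dressProj hz hq hs
    have hF := smooth_seedCol (hq s hs)
    have hidem := dressProj_idem (q := q) hz hs
    have hstar := star_dressProj (z := z) (q := q) s
    have hfix := dressProj_mul_dressCol (q := q) hz hs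
    obtain ⟨Ξ, hΞ⟩ := exists_dressCol_mul_eq (z := z) (q := q) s
    obtain ⟨hlU, hlV⟩ := hlax (z (s + 1)) fun r hr => hz.ne_conj s hs r (hr.trans hs)
    -- By the product rule the term −G A₀ from the dressing cancels the A₀ from the seed, leaving
    -- the equation required by `projection_equation`.
    have hcol : ∀ (v w : ℝ × ℝ × ℝ) (A : MatField 2),
        z (s + 1) • dir v (dressing z q s (z (s + 1))) - dir w (dressing z q s (z (s + 1)))
            = A * dressing z q s (z (s + 1)) - dressing z q s (z (s + 1)) * A₀ →
        z (s + 1) • dir v (fun x y t => seedCol (q (s + 1) x y t))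
            - dir w (fun x y t => seedCol (q (s + 1) x y t))
          = A₀ * (fun x y t => seedCol (q (s + 1) x y t))
            + κ • (fun x y t => seedCol (q (s + 1) x y t)) →
        z (s + 1) • dir v (dressCol z q s) - dir w (dressCol z q s)
          = A * dressCol z q s + κ • dressCol z q s := by
      intro v w A h1 h2
      have e1 := congrArg (fun F => F * fun x y t => seedCol (q (s + 1) x y t)) h1
      have e2 := congrArg (fun F => dressing z q s (z (s + 1)) * F) h2
      rw [dressCol, dir_mul (hsm _) hF, dir_mul (hsm _) hF]
      simp only [mul_add, mul_sub, sub_mul, smul_mul_assoc, mul_smul_comm, mul_assoc,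
        smul_add] at e1 e2 ⊢
      linear_combination (norm := module) e1 + e2
    have heqU := projection_equation hπ hΨ hAs hidem hstar hfix hΞ (hcol _ _ _ hlU (hqU s hs))
    have heqV := projection_equation hπ hΨ hBs hidem hstar hfix hΞ (hcol _ _ _ hlV (hqV s hs))
    have hskew : ∀ (v : ℝ × ℝ × ℝ) (A : MatField 2), star A = -A →
        star (A + (conj (z (s + 1)) - z (s + 1)) • dir v (dressProj z q s))
          = -(A + (conj (z (s + 1)) - z (s + 1)) • dir v (dressProj z q s)) := by
      intro v A hA
      rw [star_add, hA, star_smul, ← dir_star hπ, hstar, ← starRingEnd_apply, map_sub,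
        Complex.conj_conj]
      module
    refine ⟨A + (conj (z (s + 1)) - z (s + 1)) • dir dirX (dressProj z q s),
      B + (conj (z (s + 1)) - z (s + 1)) • dir dirV (dressProj z q s),
      hA.add ((hπ.dir _).const_smul _), hB.add ((hπ.dir _).const_smul _),
      hskew _ _ hAs, hskew _ _ hBs, ?_, ?_, ?_, fun μ hμ => ?_⟩
    -- A gains (z̄ − z)∂_xπ and B gains (z̄ − z)∂_vπ, so ∂_v A = ∂_x B persists because ∂_v and ∂_x
    -- commute.
    · rw [dir_add hA ((hπ.dir _).const_smul _), dir_add hB ((hπ.dir _).const_smul _),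
        dir_const_smul _ (hπ.dir _), dir_const_smul _ (hπ.dir _), hAB, dir_comm hπ]
    · have hJ' := hJs.mul (smooth_one.add
        (hπ.const_smul (conj (z (s + 1)) / z (s + 1) - 1)))
      rw [dressMap_succ, dir_const_smul _ hJ', map_lax (hz.ne_zero hs) hπ hJs hidem heqU hU,
        smul_mul_assoc]
    · have hJ' := hJs.mul (smooth_one.add
        (hπ.const_smul (conj (z (s + 1)) / z (s + 1) - 1)))
      rw [dressMap_succ, dir_const_smul _ hJ', map_lax (hz.ne_zero hs) hπ hJs hidem heqV hX,
        smul_mul_assoc]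
    · have hμ' := hμ s (Nat.lt_succ_self s)
      obtain ⟨h1, h2⟩ := hlax μ fun r hr => hμ r (hr.trans (Nat.lt_succ_self s))
      exact ⟨simpleFactor_lax hμ' hπ (hsm μ) hidem heqU h1,
        simpleFactor_lax hμ' hπ (hsm μ) hidem heqV h2⟩

end Ward

namespace Ward

/-! ### Plane waves and the vacuum -/

/-- The linear form `α x + β y + γ t`. -/
noncomputable def phase (α β γ : ℂ) : ℝ × ℝ × ℝ →L[ℝ] ℂ :=
  (ContinuousLinearMap.fst ℝ ℝ (ℝ × ℝ)).smulRight α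
    + ((ContinuousLinearMap.fst ℝ ℝ ℝ).comp (ContinuousLinearMap.snd ℝ ℝ (ℝ × ℝ))).smulRight β
    + ((ContinuousLinearMap.snd ℝ ℝ ℝ).comp (ContinuousLinearMap.snd ℝ ℝ (ℝ × ℝ))).smulRight γ

theorem phase_apply (α β γ : ℂ) (p : ℝ × ℝ × ℝ) :
    phase α β γ p = p.1 * α + p.2.1 * β + p.2.2 * γ := by
  simp [phase]

/-- The exponential `e^{α x + β y + γ t}`. -/
noncomputable def planeWave (α β γ : ℂ) (x y t : ℝ) : ℂ := Complex.exp (α * x + β * y + γ * t)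

variable {α β γ : ℂ}

theorem planeWave_eq (p : ℝ × ℝ × ℝ) :
    planeWave α β γ p.1 p.2.1 p.2.2 = Complex.exp (phase α β γ p) := by
  rw [planeWave, phase_apply]
  ring_nf

theorem contDiff_planeWave : ContDiff ℝ ∞ fun p : ℝ × ℝ × ℝ => planeWave α β γ p.1 p.2.1 p.2.2 := by
  simp only [planeWave_eq]
  exact (phase α β γ).contDiff.cexp

theorem fderiv_planeWave (p v : ℝ × ℝ × ℝ) :
    fderiv ℝ (fun p : ℝ × ℝ × ℝ => planeWave α β γ p.1 p.2.1 p.2.2) p v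
      = phase α β γ v * planeWave α β γ p.1 p.2.1 p.2.2 := by
  simp only [planeWave_eq]
  rw [(phase α β γ).hasFDerivAt.cexp.fderiv]
  exact mul_comm _ _

theorem planeWave_ne_zero (x y t : ℝ) : planeWave α β γ x y t ≠ 0 := Complex.exp_ne_zero _

theorem planeWave_inv (x y t : ℝ) :
    (planeWave α β γ x y t)⁻¹ = planeWave (-α) (-β) (-γ) x y t := by
  rw [planeWave, ← Complex.exp_neg, planeWave]
  ring_nf

theorem conj_planeWave (x y t : ℝ) :
    conj (planeWave α β γ x y t) = planeWave (conj α) (conj β) (conj γ) x y t := by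
  rw [planeWave, ← Complex.exp_conj, planeWave]
  simp

theorem norm_planeWave {j l : ℝ} (x y t : ℝ) :
    ‖planeWave (Complex.I * j) (Complex.I * l) γ x y t‖ = Real.exp (γ.re * t) := by
  rw [planeWave, Complex.norm_exp]
  simp

theorem planeWave_periodic (j l : ℤ) (x y t : ℝ) :
    planeWave (Complex.I * j) (Complex.I * l) γ (x + 2 * Real.pi) y t
        = planeWave (Complex.I * j) (Complex.I * l) γ x y t ∧
      planeWave (Complex.I * j) (Complex.I * l) γ x (y + 2 * Real.pi) t
        = planeWave (Complex.I * j) (Complex.I * l) γ x y t := by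
  constructor
  · rw [planeWave, planeWave, Complex.exp_eq_exp_iff_exists_int]
    exact ⟨j, by push_cast; ring⟩
  · rw [planeWave, planeWave, Complex.exp_eq_exp_iff_exists_int]
    exact ⟨l, by push_cast; ring⟩

/-! ### The vacuum map and its Lax pair. -/

theorem exp_smul_aMat (m : ℤ) (c : ℂ) : NormedSpace.exp (c • aMat m)
    = Matrix.diagonal ![Complex.exp (Complex.I * m * c), Complex.exp (-(Complex.I * m * c))] := by
  rw [aMat, ← Matrix.diagonal_smul, Matrix.exp_diagonal]
  congr 1
  funext i
  rw [Pi.exp_def]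
  fin_cases i <;> simp [Complex.exp_eq_exp_ℂ, mul_comm]

theorem vacuumMap_eq (m : ℤ) : vacuumMap m = fun x y t =>
    Matrix.diagonal ![planeWave (-(Complex.I * m)) (-(Complex.I * m)) 0 x y t,
      planeWave (Complex.I * m) (Complex.I * m) 0 x y t] := by
  funext x y t
  rw [vacuumMap, exp_smul_aMat]
  congr 1
  funext i
  fin_cases i <;> simp [planeWave] <;> ring_nf

theorem smooth_vacuumMap (m : ℤ) : Smooth (vacuumMap m) := by
  rw [vacuumMap_eq]
  intro a b
  fin_cases a <;> fin_cases b <;> simp [contDiff_planeWave, contDiff_const]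

theorem dir_vacuumMap (m : ℤ) (v : ℝ × ℝ × ℝ) : dir v (vacuumMap m)
    = vacuumMap m * fun _ _ _ => (-(v.1 + v.2.1) : ℂ) • aMat m := by
  rw [vacuumMap_eq]
  funext x y t
  ext a b
  change fderiv ℝ (fun p : ℝ × ℝ × ℝ => Matrix.diagonal _ a b) (x, y, t) v = _
  rw [Pi.mul_apply, Pi.mul_apply, Pi.mul_apply]
  fin_cases a <;> fin_cases b <;>
    simp [aMat, fderiv_planeWave, phase_apply, Matrix.mul_apply] <;> ring

theorem vacuumMap_periodic (m : ℤ) : DoublyPeriodic (vacuumMap m) := by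
  intro x y t
  have h1 := planeWave_periodic (γ := 0) m m x y t
  have h2 := planeWave_periodic (γ := 0) (-m) (-m) x y t
  simp only [Int.cast_neg, mul_neg] at h2
  simp only [vacuumMap_eq, h1, h2, and_self]

theorem vacuumMap_mem_SU (m : ℤ) (x y t : ℝ) :
    vacuumMap m x y t ∈ Matrix.specialUnitaryGroup (Fin 2) ℂ := by
  have h : planeWave (-(Complex.I * m)) (-(Complex.I * m)) 0 x y t
      * planeWave (Complex.I * m) (Complex.I * m) 0 x y t = 1 := by
    rw [planeWave, planeWave, ← Complex.exp_add, ← Complex.exp_zero]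
    ring_nf
  have h' := h
  rw [mul_comm] at h'
  rw [vacuumMap_eq, Matrix.mem_specialUnitaryGroup_iff, Matrix.mem_unitaryGroup_iff]
  constructor
  · rw [Matrix.star_eq_conjTranspose, Matrix.diagonal_conjTranspose, Matrix.diagonal_mul_diagonal,
      ← Matrix.diagonal_one]
    congr 1
    funext i
    fin_cases i <;> simp [conj_planeWave, h, h']
  · simp [Matrix.det_diagonal, h]

/-- The coefficient matrix of the Lax pair of the vacuum. -/
noncomputable def vacuumConn (m : ℤ) : MatField 2 := fun _ _ _ => -aMat m

theorem star_vacuumConn (m : ℤ) : star (vacuumConn m) = -vacuumConn m := by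
  funext x y t
  ext a b
  fin_cases a <;> fin_cases b <;> simp [vacuumConn, aMat, Matrix.star_apply]

/-- The ratio of the components of `ψ₀(z) (1, f(w))ᵀ`, where `ψ₀` is the extended solution of the
vacuum. -/
noncomputable def seedRatio (m j l : ℤ) (σ : ℝ) : ℝ → ℝ → ℝ → ℂ :=
  planeWave (-(Complex.I * j)) (-(Complex.I * l)) (σ - Complex.I * m)

theorem dir_seedCol_planeWave (v : ℝ × ℝ × ℝ) (x y t : ℝ) :
    dir v (fun x y t => seedCol (planeWave α β γ x y t)) x y t
      = !![0, 0; phase α β γ v * planeWave α β γ x y t, 0] := by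
  ext a b
  change fderiv ℝ (fun p : ℝ × ℝ × ℝ => seedCol _ a b) (x, y, t) v = _
  fin_cases a <;> fin_cases b <;> simp [seedCol, fderiv_planeWave]

/-- The column is normalized to have first entry 1, which the derivatives annihilate, while A₀ = −a
acts on it by −im. The shift κ = im compensates, and the second entry then needs the eigenvalue 2im.
-/
theorem seedCol_lax {m j l : ℤ} {σ : ℝ} {z : ℂ} {v w : ℝ × ℝ × ℝ}
    (h : z * phase (-(Complex.I * j)) (-(Complex.I * l)) (σ - Complex.I * m) v
      - phase (-(Complex.I * j)) (-(Complex.I * l)) (σ - Complex.I * m) w = 2 * Complex.I * m) :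
    z • dir v (fun x y t => seedCol (seedRatio m j l σ x y t))
        - dir w (fun x y t => seedCol (seedRatio m j l σ x y t))
      = vacuumConn m * (fun x y t => seedCol (seedRatio m j l σ x y t))
        + (Complex.I * m) • (fun x y t => seedCol (seedRatio m j l σ x y t)) := by
  funext x y t
  simp only [seedRatio, Pi.sub_apply, Pi.smul_apply, Pi.add_apply, Pi.mul_apply,
    dir_seedCol_planeWave]
  ext a b
  fin_cases a <;> fin_cases b <;> simp [seedCol, vacuumConn, aMat, Matrix.mul_apply]
  linear_combination planeWave (-(Complex.I * j)) (-(Complex.I * l)) (σ - Complex.I * m) x y t * h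

theorem phase_seed_U {m j l : ℤ} {σ : ℝ} {z : ℂ} (hjz : j * z = l - m + Complex.I * σ) :
    z * phase (-(Complex.I * j)) (-(Complex.I * l)) (σ - Complex.I * m) dirX
      - phase (-(Complex.I * j)) (-(Complex.I * l)) (σ - Complex.I * m) dirU
        = 2 * Complex.I * m := by
  simp only [phase_apply, dirX, dirU]
  push_cast
  linear_combination (-Complex.I) * hjz - σ * Complex.I_sq

theorem phase_seed_V {m j l : ℤ} {σ : ℝ} {z : ℂ} (hjz : j * z = l - m + Complex.I * σ)
    (hzz : j * (z * conj z) = 2 * m - j) :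
    z * phase (-(Complex.I * j)) (-(Complex.I * l)) (σ - Complex.I * m) dirV
      - phase (-(Complex.I * j)) (-(Complex.I * l)) (σ - Complex.I * m) dirX
        = 2 * Complex.I * m := by
  have hconj : j * conj z = l - m - Complex.I * σ := by
    have := congrArg conj hjz
    simpa [sub_eq_add_neg] using this
  simp only [phase_apply, dirX, dirV]
  push_cast
  linear_combination (Complex.I) * hzz - Complex.I * z * hconj + σ * z * Complex.I_sq

/-- Here ψ₀(z) = diag(e^c, e^{−c}), so ψ₀(z)(1, f)ᵀ = e^c (1, e^{−2c}f)ᵀ. The relations for jz and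
j|z|² make the terms quadratic in z cancel, and e^{−2c}f is a plane wave with integer spatial
frequencies. -/
theorem transformedProj_seedProj {m j l : ℤ} {σ : ℝ} {z : ℂ} (hz : z ≠ 0)
    (hjz : j * z = l - m + Complex.I * σ)
    (hzz : j * (z * conj z) = 2 * m - j) {ψ : ExtField 2} {G : MatField 2}
    (hψ : ∀ x y t, ψ x y t z = G x y t * vacuumExt m x y t z) :
    transformedProj z (seedProj m j z) ψ
      = fun x y t => lineProj (G x y t * seedCol (seedRatio m j l σ x y t)) := by
  have hconj : j * conj z = l - m - Complex.I * σ := by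
    have := congrArg conj hjz
    simpa [sub_eq_add_neg] using this
  have hinv : (2 * m - j) * z⁻¹ = l - m - Complex.I * σ := by
    rw [← hconj, ← hzz]
    field_simp
  funext x y t
  obtain ⟨c, hc⟩ : ∃ c : ℂ, c = Complex.I * m *
    ((1 - z) * x + (1 + z - z ^ 2) * (((t : ℂ) + y) / 2) - ((t : ℂ) - y) / 2) := ⟨_, rfl⟩
  have hf : Complex.exp (-c) * seedFun m j z (wCoord z x y t)
      = Complex.exp c * seedRatio m j l σ x y t := by
    rw [seedFun, seedRatio, planeWave, ← Complex.exp_add, ← Complex.exp_add]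
    congr 1
    rw [hc, wCoord]
    linear_combination (-Complex.I * (t + y) / 2) * hjz + (Complex.I * (t - y) / 2) * hinv
      - Complex.I * m * ((t : ℂ) - y) * (mul_inv_cancel₀ hz) - σ * t * Complex.I_sq
  rw [transformedProj, seedProj, map_range_hermProj, hermProj_span,
    
    ← lineProj_smul (Complex.exp_ne_zero c) (G x y t * seedCol (seedRatio m j l σ x y t))]
  congr 1
  rw [hψ, vacuumExt, exp_smul_aMat, ← hc]
  ext a b
  fin_cases b
  · fin_cases a <;>
      simp [seedCol, Matrix.mul_apply, Matrix.mulVec, dotProduct, Fin.sum_univ_two, mul_assoc, hf]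
        <;> ring
  · fin_cases a <;> simp [seedCol, Matrix.mul_apply]

end Ward

namespace Ward

/-! ### The poles -/

/-- The growth rate `√(m² - (j - m)² - (l - m)²)`. -/
noncomputable def growthRate (m j l : ℤ) : ℝ :=
  Real.sqrt (m ^ 2 - (j - m) ^ 2 - (l - m) ^ 2)

theorem growthRate_pos {m j l : ℤ} (h : (j - m) ^ 2 + (l - m) ^ 2 < m ^ 2) :
    0 < growthRate m j l := by
  have : ((j - m) ^ 2 + (l - m) ^ 2 : ℝ) < m ^ 2 := by exact_mod_cast h
  exact Real.sqrt_pos.2 (by linarith)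

theorem sq_growthRate {m j l : ℤ} (h : (j - m) ^ 2 + (l - m) ^ 2 < m ^ 2) :
    growthRate m j l ^ 2 = m ^ 2 - (j - m) ^ 2 - (l - m) ^ 2 := by
  have : ((j - m) ^ 2 + (l - m) ^ 2 : ℝ) < m ^ 2 := by exact_mod_cast h
  exact Real.sq_sqrt (by linarith)

/-- All that is used of the explicit pole: the modulus and angle in the statement are the polar form
of (l − m + iσ)/j. The second relation expresses (l − m)² + σ² = j(2m − j). -/
theorem pole_spec {m j l : ℤ} {θ : ℝ} (h : (j - m) ^ 2 + (l - m) ^ 2 < m ^ 2)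
    (hcos : Real.cos θ = (m.sign : ℝ) * ((l - m) / Real.sqrt (j * (2 * m - j))))
    (hsin : Real.sin θ = (m.sign : ℝ) * Real.sqrt (1 - Real.cos θ ^ 2)) :
    j ≠ 0 ∧ (j : ℂ) * pole m j θ = l - m + Complex.I * growthRate m j l ∧
      (j : ℂ) * (pole m j θ * conj (pole m j θ)) = 2 * m - j := by
  have hR : ((j - m) ^ 2 + (l - m) ^ 2 : ℝ) < m ^ 2 := by exact_mod_cast h
  have hP : (0 : ℝ) < j * (2 * m - j) := by nlinarith [sq_nonneg ((l : ℝ) - m)]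
  have hj : (j : ℝ) ≠ 0 := fun h0 => by rw [h0] at hP; simp at hP
  have hjz : j ≠ 0 := by exact_mod_cast hj
  -- The disc condition gives |j − m| < |m|, so j has the sign of m.
  have hsgn : (m.sign : ℝ) * j = |(j : ℝ)| := by
    rcases lt_trichotomy m 0 with hm | hm | hm
    · have : j < 0 := by
        by_contra hc
        nlinarith [sq_nonneg (l - m)]
      have hj' : (j : ℝ) < 0 := by exact_mod_cast this
      rw [Int.sign_eq_neg_one_of_neg hm, abs_of_neg hj']
      simp
    · subst hm
      nlinarith [sq_nonneg (j - 0), sq_nonneg (l - 0)]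
    · have : 0 < j := by
        by_contra hc
        nlinarith [sq_nonneg (l - m)]
      have hj' : (0 : ℝ) < j := by exact_mod_cast this
      rw [Int.sign_eq_one_of_pos hm, abs_of_pos hj']
      simp
  have habs : |(j : ℝ)| ≠ 0 := abs_ne_zero.2 hj
  have hS : Real.sqrt (j * (2 * m - j)) ≠ 0 := (Real.sqrt_pos.2 hP).ne'
  have hS2 : Real.sqrt (j * (2 * m - j)) ^ 2 = j * (2 * m - j) := Real.sq_sqrt hP.le
  have hr : Real.sqrt ((2 * m - j) / j) = Real.sqrt (j * (2 * m - j)) / |(j : ℝ)| := by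
    have : ((2 * m - j) / j : ℝ) = j * (2 * m - j) / j ^ 2 := by field_simp
    rw [this, Real.sqrt_div hP.le, Real.sqrt_sq_eq_abs]
  have hsg2 : (m.sign : ℝ) ^ 2 = 1 := by
    have h2 : (m.sign : ℝ) ^ 2 * j ^ 2 = j ^ 2 := by rw [← mul_pow, hsgn, sq_abs]
    exact mul_right_cancel₀ (pow_ne_zero 2 hj) (by rw [h2, one_mul])
  have hsqrt : Real.sqrt (1 - Real.cos θ ^ 2)
      = growthRate m j l / Real.sqrt (j * (2 * m - j)) := by
    rw [growthRate, ← Real.sqrt_div (by linarith)]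
    congr 1
    rw [hcos, mul_pow, hsg2, div_pow, hS2, one_mul, one_sub_div hP.ne']
    congr 1
    ring
  have hC : j * (Real.sqrt ((2 * m - j) / j) * Real.cos θ) = (l - m : ℝ) := by
    rw [hr, hcos]
    field_simp
    linear_combination ((l : ℝ) - m) * hsgn
  have hSn : j * (Real.sqrt ((2 * m - j) / j) * Real.sin θ) = growthRate m j l := by
    rw [hr, hsin, hsqrt]
    field_simp
    linear_combination growthRate m j l * hsgn
  refine ⟨hjz, ?_, ?_⟩
  · rw [pole, mul_comm Complex.I, Complex.exp_mul_I, ← Complex.ofReal_cos, ← Complex.ofReal_sin]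
    have hC' := congrArg (fun r : ℝ => (r : ℂ)) hC
    have hS' := congrArg (fun r : ℝ => (r : ℂ)) hSn
    push_cast at hC' hS' ⊢
    linear_combination hC' + Complex.I * hS'
  · rw [Complex.mul_conj, Complex.normSq_eq_norm_sq, pole, norm_mul, mul_comm Complex.I,
      Complex.norm_exp_ofReal_mul_I, mul_one, Complex.norm_real, Real.norm_eq_abs, sq_abs,
      Real.sq_sqrt]
    · push_cast
      have : (j : ℂ) ≠ 0 := by exact_mod_cast hjz
      field_simp
    · have : ((2 * m - j) / j : ℝ) = j * (2 * m - j) / j ^ 2 := by field_simp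
      rw [this]
      positivity

/-- The properties of the data `m`, `(j s, l s)` and of the poles `z s`, `1 ≤ s ≤ M`. -/
structure PoleData (m : ℤ) (j l : ℕ → ℤ) (z : ℕ → ℂ) (M : ℕ) : Prop where
  disc : ∀ s < M, (j (s + 1) - m) ^ 2 + (l (s + 1) - m) ^ 2 < m ^ 2
  ne_zero : ∀ s < M, j (s + 1) ≠ 0
  mul_pole : ∀ s < M, (j (s + 1) : ℂ) * z (s + 1)
    = l (s + 1) - m + Complex.I * growthRate m (j (s + 1)) (l (s + 1))
  mul_norm : ∀ s < M, (j (s + 1) : ℂ) * (z (s + 1) * conj (z (s + 1))) = 2 * m - j (s + 1)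
  distinct : ∀ r < M, ∀ s < M, r ≠ s → (j (r + 1), l (r + 1)) ≠ (j (s + 1), l (s + 1))

section

variable {m : ℤ} {j l : ℕ → ℤ} {z : ℕ → ℂ} {M : ℕ}

/-- Adding j to j|z|² = 2m − j gives j(1 + |z|²) = 2m, so |z| determines j. With j known, jz has
imaginary part σ > 0, which excludes conjugate poles, and its real part determines l. -/
theorem PoleData.admissible (h : PoleData m j l z M) : AdmissiblePoles z M := by
  have hjeq : ∀ r < M, ∀ s < M, z (r + 1) * conj (z (r + 1)) = z (s + 1) * conj (z (s + 1)) →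
      j (r + 1) = j (s + 1) := by
    intro r hr s hs he
    have h1 := h.mul_norm r hr
    have h2 := h.mul_norm s hs
    have hpos : (1 + z (s + 1) * conj (z (s + 1)) : ℂ) ≠ 0 := by
      rw [Complex.mul_conj]
      have := Complex.normSq_nonneg (z (s + 1))
      exact_mod_cast (by linarith : (0 : ℝ) < 1 + Complex.normSq (z (s + 1))).ne'
    have : (j (r + 1) : ℂ) = j (s + 1) := by
      apply mul_right_cancel₀ hpos
      rw [he] at h1
      linear_combination h1 - h2
    exact_mod_cast this
  constructor
  · intro r hr s hs he
    have hj := hjeq r hr s hs (by rw [he, Complex.conj_conj, mul_comm])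
    have h1 := congrArg Complex.im (h.mul_pole r hr)
    have h2 := congrArg Complex.im (h.mul_pole s hs)
    rw [he, hj] at h1
    simp at h1 h2
    have p1 := growthRate_pos (h.disc r hr)
    have p2 := growthRate_pos (h.disc s hs)
    rw [hj] at p1
    linarith
  · intro r hr s hs hrs he
    have hj := hjeq r hr s hs (by rw [he])
    have h1 := congrArg Complex.re (h.mul_pole r hr)
    have h2 := congrArg Complex.re (h.mul_pole s hs)
    rw [he, hj] at h1
    simp at h1 h2
    have hl : (l (r + 1) : ℝ) = l (s + 1) := by linarith
    exact h.distinct r hr s hs hrs (Prod.ext hj (by exact_mod_cast hl))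

/-- The seeds of the dressing, as functions of `(x, y, t)`. -/
noncomputable def seeds (m : ℤ) (j l : ℕ → ℤ) (s : ℕ) : ℝ → ℝ → ℝ → ℂ :=
  seedRatio m (j s) (l s) (growthRate m (j s) (l s))

theorem contDiff_seeds (s : ℕ) : ContDiff ℝ ∞ fun p : ℝ × ℝ × ℝ => seeds m j l s p.1 p.2.1 p.2.2 :=
  contDiff_planeWave

theorem seeds_periodic (s : ℕ) (x y t : ℝ) :
    seeds m j l s (x + 2 * Real.pi) y t = seeds m j l s x y t ∧
      seeds m j l s x (y + 2 * Real.pi) t = seeds m j l s x y t := by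
  have h := planeWave_periodic (γ := growthRate m (j s) (l s) - Complex.I * m) (-j s) (-l s) x y t
  simpa [seeds, seedRatio] using h

/-- Separating the vacuum factor ψ₀ leaves the dressing by plane waves, which is periodic although
ψ₀ need not be. -/
theorem PoleData.iterExt_eq (h : PoleData m j l z M) {s : ℕ} (hs : s ≤ M) :
    iterExt z (fun s => seedProj m (j s) (z s)) (vacuumExt m) s
      = fun x y t μ => dressing z (seeds m j l) s μ x y t * vacuumExt m x y t μ := by
  induction s with
  | zero => simp [iterExt, dressing_zero]
  | succ s ih =>
    have ih' := ih (Nat.le_of_succ_le hs)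
    rw [iterExt, ih']
    funext x y t μ
    rw [backlundExt, transformedProj_seedProj (h.admissible.ne_zero hs) (h.mul_pole s hs)
      (h.mul_norm s hs) (fun _ _ _ => rfl), ← mul_assoc]
    rfl

theorem PoleData.iterMap_eq (h : PoleData m j l z M) {s : ℕ} (hs : s ≤ M) :
    iterMap z (fun s => seedProj m (j s) (z s)) (vacuumExt m) (vacuumMap m) s
      = dressMap z (seeds m j l) (vacuumMap m) s := by
  induction s with
  | zero => rfl
  | succ s ih =>
    rw [iterMap, ih (Nat.le_of_succ_le hs), h.iterExt_eq (Nat.le_of_succ_le hs), dressMap_succ]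
    funext x y t
    rw [backlundMap, transformedProj_seedProj (h.admissible.ne_zero hs) (h.mul_pole s hs)
      (h.mul_norm s hs) (fun _ _ _ => rfl)]
    change _ = (_ : ℂ) • (_ * (1 + ((_ : ℂ) - 1) • dressProj z (seeds m j l) s x y t))
    rw [sub_smul, one_smul, add_sub_left_comm]
    rfl

theorem PoleData.isTorusWardMap (h : PoleData m j l z M) {s : ℕ} (hs : s ≤ M) :
    IsTorusWardMap (dressMap z (seeds m j l) (vacuumMap m) s) := by
  have hz := h.admissible
  have hsm := smooth_dressMap hz (q := seeds m j l) (fun s _ => contDiff_seeds (s + 1))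
    (smooth_vacuumMap m) hs
  have hSU := dressMap_mem_SU (q := seeds m j l) hz (vacuumMap_mem_SU m) hs
  refine ⟨hsm, dressMap_periodic (fun s _ => seeds_periodic (s + 1)) (vacuumMap_periodic m) hs,
    hSU, ?_⟩
  have hconn : ∀ v : ℝ × ℝ × ℝ, v.1 + v.2.1 = 1 →
      dir v (vacuumMap m) = vacuumMap m * vacuumConn m := by
    intro v hv
    have hv' : (v.1 + v.2.1 : ℂ) = 1 := by exact_mod_cast hv
    rw [dir_vacuumMap]
    simp only [hv', neg_smul, one_smul]
    rfl
  obtain ⟨A, B, -, hB, -, -, hAB, hU, hX, -⟩ := exists_lax_dressing hz (q := seeds m j l)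
    (fun s _ => contDiff_seeds (s + 1)) (smooth_vacuumMap m) (smooth_const (-aMat m))
    (star_vacuumConn m) (dir_const _) (hconn dirU (by simp [dirU])) (hconn dirX (by simp [dirX]))
    (fun s hs => seedCol_lax (phase_seed_U (h.mul_pole s hs)))
    (fun s hs => seedCol_lax (phase_seed_V (h.mul_pole s hs) (h.mul_norm s hs))) hs
  intro x y t
  rw [wardOp_eq_zero hsm hB (fun x y t => ?_) hU hX hAB]
  · rfl
  · rw [(Matrix.mem_specialUnitaryGroup_iff.1 (hSU x y t)).2]
    exact isUnit_one

/-! ### Consequences of the pairing of the poles. -/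

/-- The poles come in pairs `z`, `-z̄`. -/
def PairedPoles (z : ℕ → ℂ) (N : ℕ) : Prop := ∀ k < N, z (2 * k + 2) = -conj (z (2 * k + 1))

/-- Each pair contributes z(−z̄)/|z|² = −1, the origin of the sign (−1)^N. -/
theorem PairedPoles.prod_unit {N : ℕ} (h : PairedPoles z N)
    (h0 : ∀ r < 2 * N, z (r + 1) ≠ 0) :
    ∏ r ∈ Finset.range (2 * N), z (r + 1) / (‖z (r + 1)‖ : ℂ) = (-1) ^ N := by
  induction N with
  | zero => simp
  | succ N ih =>
    rw [Nat.mul_succ, Finset.prod_range_succ, Finset.prod_range_succ,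
      ih (fun k hk => h k (by omega)) (fun r hr => h0 r (by omega)), pow_succ,
      show 2 * N + 1 + 1 = 2 * N + 2 from rfl, h N (by omega)]
    have hz := h0 (2 * N) (by omega)
    have hn : (‖z (2 * N + 1)‖ : ℂ) ≠ 0 := by simpa using hz
    have hzz : z (2 * N + 1) * conj (z (2 * N + 1)) = (‖z (2 * N + 1)‖ : ℂ) ^ 2 := by
      rw [Complex.mul_conj, Complex.normSq_eq_norm_sq]
      push_cast
      rfl
    rw [norm_neg, RCLike.norm_conj]
    field_simp
    rw [hzz]

/-- The two factors of a pair at 0 are z/z̄ and z̄/z. -/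
theorem PairedPoles.blaschke_zero {N : ℕ} (h : PairedPoles z N)
    (h0 : ∀ r < 2 * N, z (r + 1) ≠ 0) : blaschke z (2 * N) 0 = 1 := by
  rw [blaschke]
  induction N with
  | zero => simp
  | succ N ih =>
    rw [Nat.mul_succ, Finset.prod_range_succ, Finset.prod_range_succ,
      ih (fun k hk => h k (by omega)) (fun r hr => h0 r (by omega)),
      show 2 * N + 1 + 1 = 2 * N + 2 from rfl, h N (by omega)]
    have hz := h0 (2 * N) (by omega)
    have hz' : conj (z (2 * N + 1)) ≠ 0 := (map_ne_zero _).2 hz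
    simp only [map_neg, Complex.conj_conj, zero_sub, one_mul]
    field_simp

end

end Ward

namespace Ward

/-! ### Smooth functions dominated, with all derivatives, by a weight along a filter -/

/-- `f` is smooth and each of its derivatives is `O(w)` along `l`. -/
def SmoothBigO {V : Type*} [NormedAddCommGroup V] [NormedSpace ℝ V] (l : Filter (ℝ × ℝ × ℝ))
    (w : ℝ × ℝ × ℝ → ℝ) (f : ℝ × ℝ × ℝ → V) : Prop :=
  ContDiff ℝ ∞ f ∧ ∀ k : ℕ, iteratedFDeriv ℝ k f =O[l] w

namespace SmoothBigO

variable {V : Type*} [NormedAddCommGroup V] [NormedSpace ℝ V] {l : Filter (ℝ × ℝ × ℝ)}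
  {w w' : ℝ × ℝ × ℝ → ℝ} {f g : ℝ × ℝ × ℝ → V}

theorem isBigO (hf : SmoothBigO l w f) : f =O[l] w := by
  have := (hf.2 0).norm_left
  simp only [norm_iteratedFDeriv_zero] at this
  exact this.of_norm_left

theorem mono (hf : SmoothBigO l w f) (h : w =O[l] w') : SmoothBigO l w' f :=
  ⟨hf.1, fun k => (hf.2 k).trans h⟩

theorem add (hf : SmoothBigO l w f) (hg : SmoothBigO l w g) : SmoothBigO l w (f + g) := by
  refine ⟨hf.1.add hg.1, fun k => ?_⟩
  rw [iteratedFDeriv_add (hf.1.of_le (by exact_mod_cast le_top))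
    (hg.1.of_le (by exact_mod_cast le_top))]
  exact (hf.2 k).add (hg.2 k)

theorem neg (hf : SmoothBigO l w f) : SmoothBigO l w (-f) := by
  refine ⟨hf.1.neg, fun k => ?_⟩
  have : iteratedFDeriv ℝ k (-f) = -iteratedFDeriv ℝ k f := by
    funext p
    exact iteratedFDeriv_neg_apply
  rw [this]
  exact (hf.2 k).neg_left

theorem zero : SmoothBigO l w (0 : ℝ × ℝ × ℝ → V) := by
  refine ⟨contDiff_const, fun k => ?_⟩
  have : iteratedFDeriv ℝ k (0 : ℝ × ℝ × ℝ → V) = 0 := iteratedFDeriv_fun_zero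
  rw [this]
  exact Asymptotics.isBigO_zero _ _

theorem sum {ι : Type*} (s : Finset ι) {f : ι → ℝ × ℝ × ℝ → V}
    (h : ∀ i ∈ s, SmoothBigO l w (f i)) : SmoothBigO l w (∑ i ∈ s, f i) := by
  classical
  induction s using Finset.induction_on with
  | empty => exact zero
  | insert i s hi ih =>
    rw [Finset.sum_insert hi]
    exact (h i (Finset.mem_insert_self i s)).add
      (ih fun k hk => h k (Finset.mem_insert_of_mem hk))

theorem const (c : V) : SmoothBigO l (fun _ => 1) (fun _ => c) := by
  refine ⟨contDiff_const, fun k => ?_⟩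
  rcases Nat.eq_zero_or_pos k with rfl | hk
  · rw [← Asymptotics.isBigO_norm_left]
    simp only [norm_iteratedFDeriv_zero]
    exact Asymptotics.isBigO_const_const _ one_ne_zero _
  · have : iteratedFDeriv ℝ k (fun _ : ℝ × ℝ × ℝ => c) = 0 :=
      iteratedFDeriv_const_of_ne hk.ne' c
    rw [this]
    exact Asymptotics.isBigO_zero _ _

theorem fderiv_right (hf : SmoothBigO l w f) : SmoothBigO l w (fderiv ℝ f) := by
  refine ⟨hf.1.fderiv_right (by simp), fun k => ?_⟩
  refine Asymptotics.IsBigO.of_norm_left ?_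
  simp only [norm_iteratedFDeriv_fderiv]
  exact (hf.2 (k + 1)).norm_left

/-- The Leibniz bound. Only orders up to k are assumed, so that it can be used inside inductions on
the order of differentiation. -/
theorem iteratedFDeriv_smul_isBigO {a : ℝ × ℝ × ℝ → ℂ} {V : Type*} [NormedAddCommGroup V]
    [NormedSpace ℂ V] {f : ℝ × ℝ × ℝ → V}
    (hac : ContDiff ℝ ∞ a) (hfc : ContDiff ℝ ∞ f) (k : ℕ)
    (ha : ∀ i ≤ k, iteratedFDeriv ℝ i a =O[l] w) (hf : ∀ i ≤ k, iteratedFDeriv ℝ i f =O[l] w') :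
    iteratedFDeriv ℝ k (fun p => a p • f p) =O[l] (w * w') := by
  have h1 : iteratedFDeriv ℝ k (fun p => a p • f p) =O[l] fun p =>
      ∑ i ∈ Finset.range (k + 1), (k.choose i : ℝ) * ‖iteratedFDeriv ℝ i a p‖ *
        ‖iteratedFDeriv ℝ (k - i) f p‖ := by
    refine Asymptotics.IsBigO.of_bound 1 (Filter.Eventually.of_forall fun p => ?_)
    rw [one_mul]
    exact (norm_iteratedFDeriv_smul_le hac hfc p (by exact_mod_cast le_top)).trans
      (le_abs_self _)
  refine h1.trans (Asymptotics.IsBigO.fun_sum fun i hi => ?_)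
  have hik : i ≤ k := Nat.lt_succ_iff.1 (Finset.mem_range.1 hi)
  exact ((ha i hik).norm_left.const_mul_left _).mul (hf (k - i) (Nat.sub_le k i)).norm_left

theorem smul {a : ℝ × ℝ × ℝ → ℂ} {V : Type*} [NormedAddCommGroup V]
    [NormedSpace ℂ V] {f : ℝ × ℝ × ℝ → V} (ha : SmoothBigO l w a) (hf : SmoothBigO l w' f) :
    SmoothBigO l (w * w') (fun p => a p • f p) :=
  ⟨ha.1.smul hf.1, fun k => iteratedFDeriv_smul_isBigO ha.1 hf.1 k (fun i _ => ha.2 i)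
    fun i _ => hf.2 i⟩

variable {a b : ℝ × ℝ × ℝ → ℂ}

theorem mul (ha : SmoothBigO l w a) (hb : SmoothBigO l w' b) : SmoothBigO l (w * w') (a * b) :=
  ha.smul hb

theorem bounded_mul (ha : SmoothBigO l (fun _ => 1) a) (hb : SmoothBigO l w b) :
    SmoothBigO l w (a * b) := by
  simpa [Pi.mul_def] using ha.mul hb

theorem const_mul (c : ℂ) (hb : SmoothBigO l w b) : SmoothBigO l w (fun p => c * b p) :=
  (const c).bounded_mul hb

theorem conjugate (ha : SmoothBigO l w a) : SmoothBigO l w (fun p => conj (a p)) := by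
  refine ⟨Complex.conjCLE.contDiff.comp ha.1, fun k => ?_⟩
  refine Asymptotics.IsBigO.of_norm_left ?_
  have h : ∀ p, ‖iteratedFDeriv ℝ k (fun p => starRingEnd ℂ (a p)) p‖
      = ‖iteratedFDeriv ℝ k a p‖ := fun p =>
    Complex.conjLIE.norm_iteratedFDeriv_comp_left a p k
  simp only [h]
  exact (ha.2 k).norm_left

/-- Induction on the order through D(1/a) = −a⁻² Da: derivatives of order k + 1 of 1/a involve only
those of order at most k of 1/a, and those of Da. -/
theorem inv (ha : SmoothBigO l (fun _ => 1) a) (h0 : ∀ p, a p ≠ 0)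
    (hb : (fun p => (a p)⁻¹) =O[l] (fun _ => (1 : ℝ))) :
    SmoothBigO l (fun _ => 1) (fun p => (a p)⁻¹) := by
  have hc : ContDiff ℝ ∞ fun p => (a p)⁻¹ := ha.1.inv h0
  refine ⟨hc, fun k => ?_⟩
  induction k using Nat.strong_induction_on with
  | _ k ih =>
    rcases k with _ | k
    · refine Asymptotics.IsBigO.of_norm_left ?_
      simp only [norm_iteratedFDeriv_zero]
      exact hb.norm_left
    · have hd : fderiv ℝ (fun p => (a p)⁻¹)
          = fun p => ((a p)⁻¹ * (a p)⁻¹) • (-fderiv ℝ a p) := by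
        funext p
        have h1 := (ha.1.differentiable (by simp) p).hasFDerivAt
        have h2 := (hasDerivAt_inv (h0 p)).comp_hasFDerivAt p h1
        change fderiv ℝ ((fun z => z⁻¹) ∘ a) p = _
        rw [h2.fderiv]
        rw [pow_two, mul_inv, smul_neg]
        exact neg_smul ((a p)⁻¹ * (a p)⁻¹) (fderiv ℝ a p)
      have hle : ∀ i ≤ k, iteratedFDeriv ℝ i (fun p => (a p)⁻¹) =O[l] (fun _ => (1 : ℝ)) :=
        fun i hi => ih i (Nat.lt_succ_iff.2 hi)
      have hsq : ∀ i ≤ k,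
          iteratedFDeriv ℝ i (fun p => (a p)⁻¹ * (a p)⁻¹) =O[l] (fun _ => (1 : ℝ)) := by
        intro i hi
        have := iteratedFDeriv_smul_isBigO hc hc i (fun j hj => hle j (hj.trans hi))
          (fun j hj => hle j (hj.trans hi))
        simpa [Pi.mul_def] using this
      refine Asymptotics.IsBigO.of_norm_left ?_
      simp only [← norm_iteratedFDeriv_fderiv]
      rw [hd]
      have hn := ha.fderiv_right.neg
      have := iteratedFDeriv_smul_isBigO (hc.mul hc) hn.1 k hsq fun i _ => hn.2 i
      simpa [Pi.mul_def] using this.norm_left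

theorem cexp (L : ℝ × ℝ × ℝ →L[ℝ] ℂ) :
    SmoothBigO l (fun p => ‖Complex.exp (L p)‖) (fun p => Complex.exp (L p)) := by
  have hc : ContDiff ℝ ∞ fun p => Complex.exp (L p) := L.contDiff.cexp
  refine ⟨hc, fun k => ?_⟩
  induction k using Nat.strong_induction_on with
  | _ k ih =>
    rcases k with _ | k
    · refine Asymptotics.IsBigO.of_norm_left ?_
      simp only [norm_iteratedFDeriv_zero]
      exact Asymptotics.isBigO_refl _ _
    · have hd : fderiv ℝ (fun p => Complex.exp (L p)) = fun p => Complex.exp (L p) • L := by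
        funext p
        exact L.hasFDerivAt.cexp.fderiv
      refine Asymptotics.IsBigO.of_norm_left ?_
      simp only [← norm_iteratedFDeriv_fderiv]
      rw [hd]
      have := iteratedFDeriv_smul_isBigO hc contDiff_const k
        (fun i hi => ih i (Nat.lt_succ_iff.2 hi)) fun i _ => (const (l := l) L).2 i
      simpa [Pi.mul_def] using this.norm_left

end SmoothBigO

end Ward

namespace Ward

/-! ### Asymptotics of the dressing for small seeds -/

section

variable {l : Filter (ℝ × ℝ × ℝ)} {w : ℝ × ℝ × ℝ → ℝ}

theorem SmoothBigO.congr {w : ℝ × ℝ × ℝ → ℝ} {f g : ℝ × ℝ × ℝ → ℂ} (hf : SmoothBigO l w f)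
    (h : ∀ p, f p = g p) : SmoothBigO l w g := by
  rwa [← funext h]

theorem SmoothBigO.to_bounded (hw : Filter.Tendsto w l (nhds 0)) {f : ℝ × ℝ × ℝ → ℂ}
    (hf : SmoothBigO l w f) : SmoothBigO l (fun _ => 1) f :=
  hf.mono (hw.isBigO_one ℝ)

theorem isBigO_mul_self (hw : Filter.Tendsto w l (nhds 0)) : (w * w) =O[l] w := by
  have h := (hw.isBigO_one ℝ).mul (Asymptotics.isBigO_refl w l)
  simp only [one_mul] at h
  exact h

theorem SmoothBigO.of_sq (hw : Filter.Tendsto w l (nhds 0)) {f : ℝ × ℝ × ℝ → ℂ}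
    (hf : SmoothBigO l (w * w) f) : SmoothBigO l w f :=
  hf.mono (isBigO_mul_self hw)

theorem SmoothBigO.bounded_of_sub_const (hw : Filter.Tendsto w l (nhds 0)) {f : ℝ × ℝ × ℝ → ℂ}
    {d : ℂ} (hf : SmoothBigO l (w * w) (fun p => f p - d)) : SmoothBigO l (fun _ => 1) f :=
  (((hf.of_sq hw).to_bounded hw).add (.const d)).congr fun p => by simp

/-- Asymptotics of the projection onto `(v₁, v₂)ᵀ` when `v₁` is close to a nonzero constant and
`v₂` is small. -/
theorem lineProj_asymptotics (hw : Filter.Tendsto w l (nhds 0)) {Ψ : MatField 2}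
    (hcol : ∀ x y t a, Ψ x y t a 1 = 0) (h0 : ∀ x y t, colNormSq (Ψ x y t) ≠ 0) {d : ℂ}
    (hd : d ≠ 0) (h1 : SmoothBigO l (w * w) (fun p => entry Ψ 0 0 p - d))
    (h2 : SmoothBigO l w (entry Ψ 1 0)) :
    SmoothBigO l (w * w) (fun p => entry (fun x y t => lineProj (Ψ x y t)) 0 0 p - 1) ∧
    SmoothBigO l w (entry (fun x y t => lineProj (Ψ x y t)) 0 1) ∧
    SmoothBigO l (w * w)
      (fun p => entry (fun x y t => lineProj (Ψ x y t)) 1 0 p - entry Ψ 1 0 p / d) ∧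
    SmoothBigO l (w * w) (entry (fun x y t => lineProj (Ψ x y t)) 1 1) := by
  have hp : ∀ a b p, entry (fun x y t => lineProj (Ψ x y t)) a b p
      = (colNormSq (Ψ p.1 p.2.1 p.2.2))⁻¹ * (entry Ψ a 0 p * conj (entry Ψ b 0 p)) :=
    fun a b p => lineProj_apply (hcol p.1 p.2.1 p.2.2) a b
  have hn : ∀ p : ℝ × ℝ × ℝ, colNormSq (Ψ p.1 p.2.1 p.2.2)
      = entry Ψ 0 0 p * conj (entry Ψ 0 0 p) + entry Ψ 1 0 p * conj (entry Ψ 1 0 p) :=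
    fun p => rfl
  have hn0 : ∀ p : ℝ × ℝ × ℝ, colNormSq (Ψ p.1 p.2.1 p.2.2) ≠ 0 := fun p => h0 _ _ _
  have hb1 : SmoothBigO l (fun _ => 1) (entry Ψ 0 0) := h1.bounded_of_sub_const hw
  have hsq := h2.mul h2.conjugate
  -- The difference equals v̄₁(v₁ − d) + |v₂|².
  have hnd : SmoothBigO l (w * w) (fun p => colNormSq (Ψ p.1 p.2.1 p.2.2)
      - d * conj (entry Ψ 0 0 p)) :=
    ((hb1.conjugate.bounded_mul h1).add hsq).congr fun p => by
      simp only [Pi.add_apply, Pi.mul_apply, hn]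
      ring
  have hnc : SmoothBigO l (w * w) (fun p => colNormSq (Ψ p.1 p.2.1 p.2.2) - d * conj d) :=
    (hnd.add (h1.conjugate.const_mul d)).congr fun p => by
      simp only [Pi.add_apply, map_sub]
      ring
  have hnb := hnc.bounded_of_sub_const hw
  have hlim : Filter.Tendsto (fun p : ℝ × ℝ × ℝ => colNormSq (Ψ p.1 p.2.1 p.2.2)) l
      (nhds (d * conj d)) := by
    have h3 := (hnc.of_sq hw).isBigO.trans_tendsto hw
    simpa using h3.add_const (d * conj d)
  have hdd : d * conj d ≠ 0 := mul_ne_zero hd ((map_ne_zero _).2 hd)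
  have hinv : SmoothBigO l (fun _ => 1) (fun p => (colNormSq (Ψ p.1 p.2.1 p.2.2))⁻¹) :=
    hnb.inv hn0 ((hlim.inv₀ hdd).isBigO_one ℝ)
  have h11 : SmoothBigO l (w * w) (entry (fun x y t => lineProj (Ψ x y t)) 1 1) :=
    (hinv.bounded_mul hsq).congr fun p => (hp 1 1 p).symm
  refine ⟨h11.neg.congr fun p => ?_, ?_, ?_, h11⟩
  -- The projection has trace 1, so this entry minus 1 is the negative of the other diagonal entry.
  · rw [Pi.neg_apply, hp, hp, neg_eq_iff_add_eq_zero]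
    have := hn0 p
    field_simp
    rw [hn]
    ring
  · exact (hinv.bounded_mul (hb1.bounded_mul h2.conjugate)).congr fun p => (hp 0 1 p).symm
  -- With n = |v₁|² + |v₂|², the difference v₂v̄₁/n − v₂/d equals −v₂(n − d v̄₁)/(dn).
  · refine (((hinv.bounded_mul (h2.to_bounded hw)).bounded_mul hnd).const_mul (-d⁻¹)).congr
      fun p => ?_
    simp only [Pi.mul_apply, hp]
    have := hn0 p
    field_simp
    ring

variable {z : ℕ → ℂ} {q : ℕ → ℝ → ℝ → ℝ → ℂ} {M : ℕ}

theorem entry_dressing_succ (s : ℕ) (μ : ℂ) (a b : Fin 2) (p : ℝ × ℝ × ℝ) :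
    entry (dressing z q (s + 1) μ) a b p = entry (dressing z q s μ) a b p
      + (conj (z (s + 1)) - z (s + 1)) / (μ - conj (z (s + 1))) *
        (entry (dressProj z q s) a 0 p * entry (dressing z q s μ) 0 b p
          + entry (dressProj z q s) a 1 p * entry (dressing z q s μ) 1 b p) := by
  rw [dressing_succ, add_mul, one_mul, smul_mul_assoc]
  simp only [entry, Pi.mul_apply, Pi.add_apply, Pi.smul_apply, Matrix.add_apply, Matrix.smul_apply, Matrix.mul_apply, Fin.sum_univ_two,
    smul_eq_mul]

/-- First order expansion of the dressing in the seeds. -/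
theorem dressing_asymptotics (hz : AdmissiblePoles z M) (hw : Filter.Tendsto w l (nhds 0))
    (hq : ∀ s < M, SmoothBigO l w fun p => q (s + 1) p.1 p.2.1 p.2.2) {s : ℕ} (hs : s ≤ M) :
    ∃ K : ℕ → ℂ, (∀ r < s, K r ≠ 0) ∧
      ∀ μ, (∀ r < s, μ ≠ z (r + 1)) → (∀ r < s, μ ≠ conj (z (r + 1))) →
        SmoothBigO l (w * w) (fun p => entry (dressing z q s μ) 0 0 p - blaschke z s μ) ∧
        SmoothBigO l w (entry (dressing z q s μ) 0 1) ∧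
        SmoothBigO l (w * w) (fun p => entry (dressing z q s μ) 1 0 p
          - ∑ r ∈ Finset.range s, blaschke z s μ * (K r / (μ - z (r + 1)))
            * q (r + 1) p.1 p.2.1 p.2.2) ∧
        SmoothBigO l (w * w) (fun p => entry (dressing z q s μ) 1 1 p - 1) := by
  induction s with
  | zero =>
    refine ⟨fun _ => 0, by simp, fun μ _ _ => ?_⟩
    have h : ∀ f : ℝ × ℝ × ℝ → ℂ, (∀ p, 0 = f p) → SmoothBigO l (w * w) f :=
      fun f hf => SmoothBigO.zero.congr hf
    exact ⟨h _ (by simp [dressing_zero, entry, blaschke]),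
      (h _ (by simp [dressing_zero, entry])).of_sq hw,
      h _ (by simp [dressing_zero, entry]), h _ (by simp [dressing_zero, entry])⟩
  | succ s ih =>
    obtain ⟨K, hK, hG⟩ := ih (Nat.le_of_succ_le hs)
    have hlin : ∀ c : ℕ → ℂ, SmoothBigO l w
        (fun p => ∑ r ∈ Finset.range s, c r * q (r + 1) p.1 p.2.1 p.2.2) := fun c =>
      (SmoothBigO.sum (Finset.range s) fun r hr => (hq r ((Finset.mem_range.1 hr).trans
        hs)).const_mul (c r)).congr fun p => by simp
    obtain ⟨z', hz'⟩ : ∃ z', z' = z (s + 1) := ⟨_, rfl⟩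
    -- The limit of the first component of the vector spanning the next line; it is nonzero, so this
    -- line tends to the first coordinate axis.
    obtain ⟨d, hd⟩ : ∃ d, d = blaschke z s z' := ⟨_, rfl⟩
    have hd0 : d ≠ 0 := by
      rw [hd, hz']
      exact hz.blaschke_ne_zero hs
    have hzne : ∀ r < s, z' ≠ z (r + 1) := fun r hr => by
      rw [hz']
      exact hz.ne s hs r (hr.trans hs) hr.ne'
    have hzc : ∀ r ≤ s, z (r + 1) ≠ conj z' := fun r hr => by
      rw [hz']
      exact hz.ne_conj r (hr.trans_lt hs) s hs
    obtain ⟨a1, a2, a3, a4⟩ := hG z' hzne fun r hr => by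
      rw [hz']
      exact hz.ne_conj s hs r (hr.trans hs)
    have hqs := hq s hs
    have hcol : ∀ a p, entry (dressCol z q s) a 0 p = entry (dressing z q s z') a 0 p
        + entry (dressing z q s z') a 1 p * q (s + 1) p.1 p.2.1 p.2.2 := fun a p => by
      rw [hz']
      simp [entry, dressCol, seedCol, Matrix.mul_apply, Fin.sum_univ_two]
    have hv1 : SmoothBigO l (w * w) (fun p => entry (dressCol z q s) 0 0 p - d) :=
      (a1.add (a2.mul hqs)).congr fun p => by
        simp only [Pi.add_apply, Pi.mul_apply, hcol, hd]
        ring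
    have hv2 : SmoothBigO l (w * w) (fun p => entry (dressCol z q s) 1 0 p
        - (∑ r ∈ Finset.range s, d * (K r / (z' - z (r + 1))) * q (r + 1) p.1 p.2.1 p.2.2
          + q (s + 1) p.1 p.2.1 p.2.2)) :=
      (a3.add ((hqs.to_bounded hw).bounded_mul a4)).congr fun p => by
        simp only [Pi.add_apply, Pi.mul_apply, hcol, hd]
        ring
    have hlin0 := (hlin fun r => d * (K r / (z' - z (r + 1)))).add hqs
    have hv2' : SmoothBigO l w (entry (dressCol z q s) 1 0) :=
      ((hv2.of_sq hw).add hlin0).congr fun p => by simp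
    obtain ⟨p1, p2, p3, p4⟩ := lineProj_asymptotics hw (dressCol_col s)
      (colNormSq_dressCol_ne_zero hz hs) hd0 hv1 hv2'
    change SmoothBigO l (w * w) (fun p => entry (dressProj z q s) 0 0 p - 1) at p1
    change SmoothBigO l w (entry (dressProj z q s) 0 1) at p2
    change SmoothBigO l (w * w)
      (fun p => entry (dressProj z q s) 1 0 p - entry (dressCol z q s) 1 0 p / d) at p3
    change SmoothBigO l (w * w) (entry (dressProj z q s) 1 1) at p4
    have p3w : SmoothBigO l w (entry (dressProj z q s) 1 0) :=
      ((p3.of_sq hw).add (hv2'.const_mul d⁻¹)).congr fun p => by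
        simp only [Pi.add_apply]
        ring
    have p3l : SmoothBigO l (w * w) (fun p => entry (dressProj z q s) 1 0 p
        - d⁻¹ * (∑ r ∈ Finset.range s, d * (K r / (z' - z (r + 1))) * q (r + 1) p.1 p.2.1 p.2.2
          + q (s + 1) p.1 p.2.1 p.2.2)) :=
      (p3.add (hv2.const_mul d⁻¹)).congr fun p => by
        simp only [Pi.add_apply]
        ring
    -- The new line has slope v₂/d, which gives q (s + 1) the coefficient (z̄′ − z′)/d; old
    -- coefficients pick up a factor depending only on the poles. Splitting off the Blaschke product
    -- makes K independent of μ and its nonvanishing visible.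
    refine ⟨fun r => if r = s then (conj z' - z') / d
      else K r * ((z (r + 1) - conj z') / (z (r + 1) - z')), fun r hr => ?_, fun μ hμ hμ' => ?_⟩
    · dsimp only
      split_ifs with h
      · refine div_ne_zero (sub_ne_zero.2 fun h => hzc s le_rfl ?_) hd0
        rw [h, hz']
      · have hrs : r < s := lt_of_le_of_ne (Nat.lt_succ_iff.1 hr) h
        exact mul_ne_zero (hK r hrs) (div_ne_zero (sub_ne_zero.2 (hzc r hrs.le))
          (sub_ne_zero.2 (hzne r hrs).symm))
    obtain ⟨g1, g2, g3, g4⟩ := hG μ (fun r hr => hμ r (hr.trans (Nat.lt_succ_self s)))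
      fun r hr => hμ' r (hr.trans (Nat.lt_succ_self s))
    have g3w : SmoothBigO l w (entry (dressing z q s μ) 1 0) :=
      ((g3.of_sq hw).add (hlin _)).congr fun p => by simp only [Pi.add_apply]; ring
    have g1b := g1.bounded_of_sub_const hw
    have g4b := g4.bounded_of_sub_const hw
    have p1b := p1.bounded_of_sub_const hw
    have hμs : μ - z' ≠ 0 := sub_ne_zero.2 (hz' ▸ hμ s (Nat.lt_succ_self s))
    have hμs' : μ - conj z' ≠ 0 := sub_ne_zero.2 (hz' ▸ hμ' s (Nat.lt_succ_self s))
    obtain ⟨k, hk⟩ : ∃ k, k = (conj z' - z') / (μ - conj z') := ⟨_, rfl⟩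
    have hk1 : (μ - z') / (μ - conj z') = 1 + k := by
      rw [hk]
      field_simp
      ring
    have hent := entry_dressing_succ (z := z) (q := q) s μ
    rw [← hz', ← hk] at hent
    have hbl : blaschke z (s + 1) μ = blaschke z s μ * (1 + k) := by
      rw [blaschke_succ, ← hz', hk1]
    refine ⟨?_, ?_, ?_, ?_⟩
    · refine ((g1.const_mul (1 + k)).add
        (((g1b.bounded_mul p1).add (p2.mul g3w)).const_mul k)).congr fun p => ?_
      simp only [Pi.add_apply, Pi.mul_apply, hent, hbl]
      ring
    · refine (g2.add (((p1b.bounded_mul g2).add (g4b.bounded_mul p2)).const_mul k)).congr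
        fun p => ?_
      simp only [Pi.add_apply, Pi.mul_apply, hent]
      ring
    · refine (g3.add ((((g1b.bounded_mul p3l).add (((hlin0.to_bounded hw).const_mul
        d⁻¹).bounded_mul g1)).add ((g3w.to_bounded hw).bounded_mul p4)).const_mul k)).congr
        fun p => ?_
      -- For old r this is the partial fraction identity 1/(μ − z_r) + k/(z′ − z_r) = (1 + k)/(μ −
      -- z_r) · (z_r − z̄′)/(z_r − z′).
      have hsum : ∑ r ∈ Finset.range (s + 1), blaschke z (s + 1) μ *
            ((if r = s then (conj z' - z') / d
              else K r * ((z (r + 1) - conj z') / (z (r + 1) - z'))) / (μ - z (r + 1)))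
              * q (r + 1) p.1 p.2.1 p.2.2
          = ∑ r ∈ Finset.range s, blaschke z s μ * (K r / (μ - z (r + 1)))
              * q (r + 1) p.1 p.2.1 p.2.2
            + k * blaschke z s μ * d⁻¹ *
              (∑ r ∈ Finset.range s, d * (K r / (z' - z (r + 1))) * q (r + 1) p.1 p.2.1 p.2.2
                + q (s + 1) p.1 p.2.1 p.2.2) := by
        rw [Finset.sum_range_succ, if_pos rfl, mul_add, Finset.mul_sum, ← add_assoc,
          ← Finset.sum_add_distrib]
        congr 1
        · refine Finset.sum_congr rfl fun r hr => ?_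
          have hrs := Finset.mem_range.1 hr
          rw [if_neg hrs.ne, hbl, ← hk1, hk]
          have e1 : μ - z (r + 1) ≠ 0 := sub_ne_zero.2 (hμ r (hrs.trans (Nat.lt_succ_self s)))
          have e2 : z' - z (r + 1) ≠ 0 := sub_ne_zero.2 (hzne r hrs)
          have e3 : z (r + 1) - z' ≠ 0 := sub_ne_zero.2 (hzne r hrs).symm
          rw [show z' - z (r + 1) = -(z (r + 1) - z') by ring]
          field_simp
          ring
        · rw [hbl, ← hk1, ← hz', hk]
          field_simp
      rw [hsum]
      simp only [Pi.add_apply, Pi.mul_apply, hent]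
      ring
    · refine (g4.add (((p3w.mul g2).add (g4b.bounded_mul p4)).const_mul k)).congr fun p => ?_
      simp only [Pi.add_apply, Pi.mul_apply, hent]
      ring

end

end Ward

namespace Ward

/-! ### Inverting the seeds -/

/-- The matrix exchanging the two coordinates. -/
def swapMat : Matrix (Fin 2) (Fin 2) ℂ := !![0, 1; 1, 0]

theorem swapMat_mul_self : swapMat * swapMat = 1 := by
  ext a b
  fin_cases a <;> fin_cases b <;> simp [swapMat]

theorem swapMat_mul_mul (F : Matrix (Fin 2) (Fin 2) ℂ) :
    swapMat * F * swapMat = !![F 1 1, F 1 0; F 0 1, F 0 0] := by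
  obtain ⟨a, b, c, d, rfl⟩ : ∃ a b c d, F = !![a, b; c, d] := ⟨_, _, _, _, Matrix.eta_fin_two F⟩
  simp [swapMat]

theorem lineProj_swapMat_mul (Ψ : Matrix (Fin 2) (Fin 2) ℂ) :
    lineProj (swapMat * Ψ) = swapMat * lineProj Ψ * swapMat := by
  have hs : swapMatᴴ = swapMat := by
    ext a b
    fin_cases a <;> fin_cases b <;> simp [swapMat]
  have hn : colNormSq (swapMat * Ψ) = colNormSq Ψ := by
    simp [colNormSq, swapMat, Matrix.mul_apply, Fin.sum_univ_two, add_comm]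
  rw [lineProj, hn, lineProj, Matrix.conjTranspose_mul, hs, Matrix.mul_smul, Matrix.smul_mul]
  simp only [Matrix.mul_assoc]

/-- The vectors (1, q)ᵀ and (q⁻¹, 1)ᵀ span the same line, so inverting all seeds conjugates the
whole construction by the swap. Large seeds are thereby reduced to small ones. -/
theorem dressing_eq_swapMat {z : ℕ → ℂ} {q : ℕ → ℝ → ℝ → ℝ → ℂ}
    (hq : ∀ s x y t, q s x y t ≠ 0) (s : ℕ) (μ : ℂ) (x y t : ℝ) :
    dressing z q s μ x y t
      = swapMat * dressing z (fun s x y t => (q s x y t)⁻¹) s μ x y t * swapMat := by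
  induction s generalizing μ with
  | zero =>
    rw [dressing_zero, dressing_zero]
    change 1 = swapMat * 1 * swapMat
    rw [mul_one, swapMat_mul_self]
  | succ s ih =>
    have hcol : dressCol z q s x y t = q (s + 1) x y t •
        (swapMat * dressCol z (fun s x y t => (q s x y t)⁻¹) s x y t) := by
      simp only [dressCol, Pi.mul_apply]
      rw [ih, Matrix.mul_assoc, ← Matrix.mul_smul, ← Matrix.mul_smul, Matrix.mul_assoc]
      congr 2
      have := hq (s + 1) x y t
      ext a b
      fin_cases a <;> fin_cases b <;> simp [swapMat, seedCol, this]
    have hproj : dressProj z q s x y t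
        = swapMat * dressProj z (fun s x y t => (q s x y t)⁻¹) s x y t * swapMat := by
      rw [dressProj, hcol, lineProj_smul (hq _ _ _ _), lineProj_swapMat_mul]
      rfl
    simp only [dressing_succ, Pi.mul_apply, Pi.add_apply, Pi.smul_apply, Pi.one_apply]
    rw [ih, hproj]
    obtain ⟨k, hk⟩ : ∃ k, k = (conj (z (s + 1)) - z (s + 1)) / (μ - conj (z (s + 1))) := ⟨_, rfl⟩
    obtain ⟨P, hP⟩ : ∃ P, P = dressProj z (fun s x y t => (q s x y t)⁻¹) s x y t := ⟨_, rfl⟩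
    obtain ⟨G, hG⟩ : ∃ G, G = dressing z (fun s x y t => (q s x y t)⁻¹) s μ x y t := ⟨_, rfl⟩
    rw [← hk, ← hP, ← hG]
    have h1 : (1 : Matrix (Fin 2) (Fin 2) ℂ) + k • (swapMat * P * swapMat)
        = swapMat * (1 + k • P) * swapMat := by
      rw [mul_add, add_mul, mul_one, swapMat_mul_self, Matrix.mul_smul, Matrix.smul_mul]
    rw [h1]
    simp only [← Matrix.mul_assoc]
    rw [Matrix.mul_assoc _ swapMat swapMat, swapMat_mul_self, mul_one]

/-! ### Linear modes of the vacuum -/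

/-- The strictly upper triangular field with entry `f`. -/
def upper (f : ℝ → ℝ → ℝ → ℂ) : MatField 2 := fun x y t => !![0, f x y t; 0, 0]

/-- A finite sum of plane waves with the same exponent in time. -/
noncomputable def waveSum (s : Finset ℕ) (b α β : ℕ → ℂ) (γ : ℂ) (x y t : ℝ) : ℂ :=
  ∑ r ∈ s, b r * planeWave (α r) (β r) γ x y t

variable {s : Finset ℕ} {b α β : ℕ → ℂ} {γ : ℂ}

theorem contDiff_waveSum :
    ContDiff ℝ ∞ fun p : ℝ × ℝ × ℝ => waveSum s b α β γ p.1 p.2.1 p.2.2 := by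
  unfold waveSum
  exact ContDiff.sum fun r _ => contDiff_const.mul contDiff_planeWave

theorem smooth_upper {f : ℝ → ℝ → ℝ → ℂ}
    (hf : ContDiff ℝ ∞ fun p : ℝ × ℝ × ℝ => f p.1 p.2.1 p.2.2) : Smooth (upper f) := by
  intro a b
  fin_cases a <;> fin_cases b <;> simp [upper, contDiff_const, hf]

theorem dir_upper_waveSum (v : ℝ × ℝ × ℝ) : dir v (upper (waveSum s b α β γ))
    = upper (waveSum s (fun r => phase (α r) (β r) γ v * b r) α β γ) := by
  have h : ∀ p : ℝ × ℝ × ℝ,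
      fderiv ℝ (fun p : ℝ × ℝ × ℝ => waveSum s b α β γ p.1 p.2.1 p.2.2) p v
        = waveSum s (fun r => phase (α r) (β r) γ v * b r) α β γ p.1 p.2.1 p.2.2 := by
    intro p
    have hd : ∀ r, DifferentiableAt ℝ
        (fun p : ℝ × ℝ × ℝ => planeWave (α r) (β r) γ p.1 p.2.1 p.2.2) p := fun r =>
      contDiff_planeWave.differentiable (by simp) p
    unfold waveSum
    rw [fderiv_fun_sum fun r _ => (hd r).const_mul (b r), sum_apply]
    refine Finset.sum_congr rfl fun r _ => ?_
    rw [fderiv_const_mul (hd r), smul_apply, fderiv_planeWave, smul_eq_mul]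
    ring
  funext x y t
  ext a c
  change fderiv ℝ (fun p : ℝ × ℝ × ℝ => upper (waveSum s b α β γ) p.1 p.2.1 p.2.2 a c)
    (x, y, t) v = _
  fin_cases a <;> fin_cases c <;> simp [upper, h]

/-- Strictly upper triangular matrices form an eigenspace of ad a, so the linearized operator acts
on each wave by a scalar. -/
theorem comm_vacuumConn_upper (m : ℤ) :
    comm (vacuumConn m) (upper (waveSum s b α β γ))
      = upper (waveSum s (fun r => -(2 * Complex.I * m) * b r) α β γ) := by
  funext x y t
  ext a c
  have ha : aMat m = !![Complex.I * m, 0; 0, -(Complex.I * m)] := by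
    ext i k
    fin_cases i <;> fin_cases k <;> simp [aMat]
  have hw : waveSum s (fun r => -(2 * Complex.I * m) * b r) α β γ x y t
      = -(2 * Complex.I * m) * waveSum s b α β γ x y t := by
    simp only [waveSum, Finset.mul_sum, mul_assoc]
  fin_cases a <;> fin_cases c <;> simp only [comm, vacuumConn, ha, upper, hw] <;> simp
  ring

theorem comm_upper_vacuumConn (m : ℤ) :
    comm (upper (waveSum s b α β γ)) (vacuumConn m)
      = upper (waveSum s (fun r => 2 * Complex.I * m * b r) α β γ) := by
  have h : ∀ F G : MatField 2, comm F G = -comm G F := fun F G => by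
    funext x y t
    simp [comm]
  rw [h, comm_vacuumConn_upper]
  funext x y t
  ext a c
  fin_cases a <;> fin_cases c <;> simp [upper, waveSum]

theorem upper_waveSum_add (b c : ℕ → ℂ) : upper (waveSum s b α β γ) + upper (waveSum s c α β γ)
    = upper (waveSum s (fun r => b r + c r) α β γ) := by
  funext x y t
  ext i k
  fin_cases i <;> fin_cases k <;> simp [upper, waveSum, add_mul, Finset.sum_add_distrib]

theorem upper_waveSum_sub (b c : ℕ → ℂ) : upper (waveSum s b α β γ) - upper (waveSum s c α β γ)
    = upper (waveSum s (fun r => b r - c r) α β γ) := by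
  funext x y t
  ext i k
  fin_cases i <;> fin_cases k <;> simp [upper, waveSum, sub_mul, Finset.sum_sub_distrib]

/-- Sums of plane waves satisfying the dispersion relation solve the linearized equation. -/
theorem linWardOp_upper_waveSum {m : ℤ} {c : ℂ} (hc : c ≠ 0)
    (hdisp : ∀ r ∈ s, γ ^ 2 - 2 * Complex.I * m * γ - α r ^ 2 - β r ^ 2
      + 2 * Complex.I * m * (α r + β r) = 0) (x y t : ℝ) :
    linWardOp (fun x y t => c • vacuumMap m x y t) (upper (waveSum s b α β γ)) x y t = 0 := by
  have hL : Smooth (fun x y t => c • vacuumMap m x y t) := (smooth_vacuumMap m).const_smul c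
  have hdir : ∀ v : ℝ × ℝ × ℝ, dir v (fun x y t => c • vacuumMap m x y t)
      = (fun x y t => c • vacuumMap m x y t) * fun _ _ _ => (-(v.1 + v.2.1) : ℂ) • aMat m := by
    intro v
    have := dir_const_smul c (smooth_vacuumMap m) v
    rw [dir_vacuumMap, ← smul_mul_assoc] at this
    exact this
  have hinv : ∀ F : MatField 2, invMul (fun x y t => c • vacuumMap m x y t)
      ((fun x y t => c • vacuumMap m x y t) * F) = F := fun F => by
    funext x y t
    refine Matrix.nonsing_inv_mul_cancel_left _ _ ?_
    rw [Matrix.det_smul, (Matrix.mem_specialUnitaryGroup_iff.1 (vacuumMap_mem_SU m x y t)).2]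
    simp [hc]
  have hP : invMul (fun x y t => c • vacuumMap m x y t) (dx fun x y t => c • vacuumMap m x y t)
      = vacuumConn m := by
    rw [dx_eq_dir hL, hdir, hinv]
    simp
    rfl
  have hQ : invMul (fun x y t => c • vacuumMap m x y t) (dy fun x y t => c • vacuumMap m x y t)
      = vacuumConn m := by
    rw [dy_eq_dir hL, hdir, hinv]
    simp
    rfl
  have hR : invMul (fun x y t => c • vacuumMap m x y t) (dt fun x y t => c • vacuumMap m x y t)
      = 0 := by
    rw [dt_eq_dir hL, hdir, hinv]
    funext x y t
    simp
  have hcomm0 : ∀ F : MatField 2, comm 0 F = 0 := fun F => by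
    funext x y t
    simp [comm]
  have hsm : ∀ b, Smooth (upper (waveSum s b α β γ)) := fun b => smooth_upper contDiff_waveSum
  simp only [linWardOp, hP, hQ, hR, hcomm0, add_zero, sub_zero]
  rw [dt_eq_dir (hsm _), dx_eq_dir (hsm _), dy_eq_dir (hsm _)]
  simp only [dir_upper_waveSum, comm_vacuumConn_upper, upper_waveSum_add]
  rw [dt_eq_dir (hsm _), dx_eq_dir (hsm _), dy_eq_dir (hsm _)]
  simp only [dir_upper_waveSum, comm_upper_vacuumConn, upper_waveSum_sub]
  have hz : waveSum s (fun r => phase (α r) (β r) γ (0, 0, 1) * (phase (α r) (β r) γ (0, 0, 1) * b r)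
      - phase (α r) (β r) γ (1, 0, 0) * (phase (α r) (β r) γ (1, 0, 0) * b r
        + -(2 * Complex.I * m) * b r)
      - phase (α r) (β r) γ (0, 1, 0) * (phase (α r) (β r) γ (0, 1, 0) * b r
        + -(2 * Complex.I * m) * b r)
      - 2 * Complex.I * m * (phase (α r) (β r) γ (0, 0, 1) * b r)) α β γ x y t = 0 := by
    refine Finset.sum_eq_zero fun r hr => mul_eq_zero_of_left ?_ _
    simp only [phase_apply]
    push_cast
    linear_combination b r * hdisp r hr
  ext i k
  fin_cases i <;> fin_cases k <;> simp only [upper, hz] <;> simp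

/-- Distinct Fourier modes are linearly independent. -/
theorem exists_waveSum_ne_zero {j l : ℕ → ℤ} {r : ℕ} (hr : r ∈ s) (hb : b r ≠ 0)
    (hinj : ∀ r ∈ s, ∀ k ∈ s, r ≠ k → (j r, l r) ≠ (j k, l k)) :
    ∃ x y, waveSum s b (fun r => Complex.I * j r) (fun r => Complex.I * l r) γ x y 0 ≠ 0 := by
  by_contra! hzero
  -- The waves at t = 0 are characters of ℝ², and distinct characters are linearly independent.
  let χ : ℕ → Multiplicative (ℝ × ℝ) →* ℂ := fun r =>
    { toFun := fun p => Complex.exp (Complex.I * j r * p.toAdd.1 + Complex.I * l r * p.toAdd.2)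
      map_one' := by simp
      map_mul' := fun p p' => by
        rw [← Complex.exp_add]
        congr 1
        simp
        ring }
  have hexp : ∀ a a' : ℤ, a ≠ a' → ∃ u : ℝ,
      Complex.exp (Complex.I * a * u) ≠ Complex.exp (Complex.I * a' * u) := by
    intro a a' ha
    have hd : (a - a' : ℂ) ≠ 0 := sub_ne_zero.2 (by exact_mod_cast ha)
    -- At this point the two exponentials have quotient e^{iπ} = −1.
    refine ⟨Real.pi / (a - a'), fun h => ?_⟩
    have h1 : Complex.exp (Complex.I * a * (Real.pi / (a - a') : ℝ))
        = Complex.exp (Complex.I * a' * (Real.pi / (a - a') : ℝ)) * -1 := by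
      rw [← Complex.exp_pi_mul_I, ← Complex.exp_add]
      congr 1
      push_cast
      field_simp
      ring
    rw [h] at h1
    have := Complex.exp_ne_zero (Complex.I * a' * (Real.pi / (a - a') : ℝ))
    apply this
    linear_combination h1 / 2
  have hχ : Function.Injective fun r : s => χ r := by
    intro r k hrk
    by_contra hne
    have hne' : (r : ℕ) ≠ k := fun h => hne (Subtype.ext h)
    have hjl := hinj r r.2 k k.2 hne'
    apply hjl
    refine Prod.ext ?_ ?_
    · by_contra hj
      obtain ⟨u, hu⟩ := hexp _ _ hj
      apply hu
      have := DFunLike.congr_fun hrk (Multiplicative.ofAdd (u, 0))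
      simpa [χ] using this
    · by_contra hj
      obtain ⟨u, hu⟩ := hexp _ _ hj
      apply hu
      have := DFunLike.congr_fun hrk (Multiplicative.ofAdd (0, u))
      simpa [χ] using this
  have hli := (linearIndependent_monoidHom (Multiplicative (ℝ × ℝ)) ℂ).comp _ hχ
  rw [Fintype.linearIndependent_iff] at hli
  refine hb (hli (fun r => b r) ?_ ⟨r, hr⟩)
  funext p
  have := hzero p.toAdd.1 p.toAdd.2
  rw [waveSum, ← Finset.sum_coe_sort] at this
  simpa [planeWave, χ] using this

end Ward

namespace Ward

/-! ### From expansions to homoclinic behaviour -/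

/-- A neighbourhood in the filter pulled back along the time coordinate contains whole slices t =
const, so bounds along it are uniform in (x, y). -/
theorem smoothLittleO_of_smoothBigO {n : ℕ} {T : Filter ℝ} {F : MatField n}
    {w : ℝ × ℝ × ℝ → ℝ} {g : ℝ → ℝ}
    (hF : ∀ a b, SmoothBigO (Filter.comap (fun p : ℝ × ℝ × ℝ => p.2.2) T) w (entry F a b))
    (hwg : w =o[Filter.comap (fun p : ℝ × ℝ × ℝ => p.2.2) T] fun p => g p.2.2)
    (hg : ∀ t, 0 ≤ g t) : SmoothLittleO T F g := by
  intro k ε hε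
  have h : ∀ᶠ p in Filter.comap (fun p : ℝ × ℝ × ℝ => p.2.2) T, ∀ a b,
      ‖iteratedFDeriv ℝ k (entry F a b) p‖ ≤ ε * g p.2.2 := by
    rw [Filter.eventually_all]
    intro a
    rw [Filter.eventually_all]
    intro b
    have := (((hF a b).2 k).trans_isLittleO hwg).bound hε
    filter_upwards [this] with p hp
    rwa [Real.norm_of_nonneg (hg _)] at hp
  rw [Filter.eventually_comap] at h
  filter_upwards [h] with t ht x y a b
  exact ht (x, y, t) rfl a b

theorem smoothBigO_entry_mul {n : ℕ} {F G : MatField n} {l : Filter (ℝ × ℝ × ℝ)}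
    {w : ℝ × ℝ × ℝ → ℝ} (hF : ∀ a b, SmoothBigO l (fun _ => 1) (entry F a b))
    (hG : ∀ a b, SmoothBigO l w (entry G a b)) (a b : Fin n) :
    SmoothBigO l w (entry (F * G) a b) := by
  rw [entry_mul]
  exact SmoothBigO.sum _ fun c _ => (hF a c).bounded_mul (hG c b)

theorem smoothBigO_planeWave {l : Filter (ℝ × ℝ × ℝ)} (j k : ℝ) (γ : ℂ) :
    SmoothBigO l (fun p => Real.exp (γ.re * p.2.2))
      (fun p => planeWave (Complex.I * j) (Complex.I * k) γ p.1 p.2.1 p.2.2) := by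
  have h := SmoothBigO.cexp (l := l) (phase (Complex.I * j) (Complex.I * k) γ)
  simpa only [← planeWave_eq, norm_planeWave] using h

theorem smoothBigO_vacuumMap {l : Filter (ℝ × ℝ × ℝ)} (m : ℤ) (c : ℂ) (a b : Fin 2) :
    SmoothBigO l (fun _ => 1) (entry (fun x y t => c • vacuumMap m x y t) a b) := by
  have h1 := smoothBigO_planeWave (l := l) m m 0
  have h2 := smoothBigO_planeWave (l := l) (-m) (-m) 0
  simp only [Complex.zero_re, zero_mul, Real.exp_zero, Complex.ofReal_neg, mul_neg,
    Complex.ofReal_intCast] at h1 h2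
  rw [vacuumMap_eq]
  fin_cases a <;> fin_cases b
  · exact (h2.const_mul c).congr fun p => by simp [entry]
  · exact SmoothBigO.zero.congr fun p => by simp [entry]
  · exact SmoothBigO.zero.congr fun p => by simp [entry]
  · exact (h1.const_mul c).congr fun p => by simp [entry]

/-- In SU(2) the adjoint is the inverse, which for determinant 1 is the adjugate. -/
theorem specialUnitary_entries {U : Matrix (Fin 2) (Fin 2) ℂ}
    (hU : U ∈ Matrix.specialUnitaryGroup (Fin 2) ℂ) :
    U 1 1 = conj (U 0 0) ∧ U 1 0 = -conj (U 0 1) := by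
  obtain ⟨h1, h2⟩ := Matrix.mem_specialUnitaryGroup_iff.1 hU
  have h3 : star U = U.adjugate := by
    rw [← mul_one (star U), ← one_smul ℂ (1 : Matrix (Fin 2) (Fin 2) ℂ), ← h2,
      ← Matrix.mul_adjugate, ← Matrix.mul_assoc, Matrix.mem_unitaryGroup_iff'.1 h1, one_mul]
  rw [Matrix.adjugate_fin_two] at h3
  have e1 := congrFun (congrFun h3 0) 0
  have e2 := congrFun (congrFun h3 1) 0
  simp [Matrix.star_apply] at e1 e2
  exact ⟨e1.symm, by rw [e2, neg_neg]⟩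

/-- A weight `e^{ε a t}` dominates `e^{ε b t}` if `a < b` and `ε t → -∞`. -/
theorem isLittleO_exp_weight {T : Filter ℝ} {ε a b : ℝ}
    (hT : Filter.Tendsto (fun t => ε * t) T Filter.atBot) (hab : a < b) :
    (fun p : ℝ × ℝ × ℝ => Real.exp (ε * b * p.2.2))
      =o[Filter.comap (fun p : ℝ × ℝ × ℝ => p.2.2) T]
      fun p => Real.exp (ε * a * p.2.2) := by
  rw [Real.isLittleO_exp_comp_exp_comp]
  have h1 : Filter.Tendsto (fun t => (a - b) * (ε * t)) T Filter.atTop :=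
    hT.const_mul_atBot_of_neg (sub_neg.2 hab)
  have h2 := h1.comp (Filter.tendsto_comap (f := fun p : ℝ × ℝ × ℝ => p.2.2))
  refine h2.congr fun p => ?_
  simp only [Function.comp_apply]
  ring

theorem isBigO_exp_weight {T : Filter ℝ} {ε a b : ℝ}
    (hT : Filter.Tendsto (fun t => ε * t) T Filter.atBot) (hab : a ≤ b) :
    (fun p : ℝ × ℝ × ℝ => Real.exp (ε * b * p.2.2))
      =O[Filter.comap (fun p : ℝ × ℝ × ℝ => p.2.2) T]
      fun p => Real.exp (ε * a * p.2.2) := by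
  rcases hab.eq_or_lt with rfl | h
  · exact Asymptotics.isBigO_refl _ _
  · exact (isLittleO_exp_weight hT h).isBigO

theorem tendsto_exp_weight {T : Filter ℝ} {ε a : ℝ}
    (hT : Filter.Tendsto (fun t => ε * t) T Filter.atBot) (ha : 0 < a) :
    Filter.Tendsto (fun p : ℝ × ℝ × ℝ => Real.exp (ε * a * p.2.2))
      (Filter.comap (fun p : ℝ × ℝ × ℝ => p.2.2) T) (nhds 0) := by
  have h := isLittleO_exp_weight hT ha
  simp only [mul_zero, zero_mul, Real.exp_zero] at h
  exact (Asymptotics.isLittleO_one_iff ℝ).1 h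

/-- A map `L U` with `U` in `SU(2)` is tangent to the linear mode of `L` formed by the slowest waves
in the first order expansion of `U`. -/
theorem exists_tangent_mode {T : Filter ℝ} {ε : ℝ}
    (hT : Filter.Tendsto (fun t => ε * t) T Filter.atBot) (hε : ε ^ 2 = 1) {m : ℤ} {j l : ℕ → ℤ}
    {M : ℕ} (hM : 0 < M) {σ : ℕ → ℝ} (hσ : ∀ r < M, 0 < σ r)
    (hσ2 : ∀ r < M, σ r ^ 2 = m ^ 2 - (j r - m) ^ 2 - (l r - m) ^ 2)
    (hinj : ∀ r < M, ∀ k < M, r ≠ k → (j r, l r) ≠ (j k, l k)) {c : ℂ} (hc : c ≠ 0)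
    {J U : MatField 2} (hJ : J = (fun x y t => c • vacuumMap m x y t) * U)
    (hU : ∀ x y t, U x y t ∈ Matrix.specialUnitaryGroup (Fin 2) ℂ)
    (hexp : ∀ σ₀, 0 < σ₀ → (∀ r < M, σ₀ ≤ σ r) → ∃ b : ℕ → ℂ, (∀ r < M, b r ≠ 0) ∧
      SmoothBigO (Filter.comap (fun p : ℝ × ℝ × ℝ => p.2.2) T)
        ((fun p => Real.exp (ε * σ₀ * p.2.2)) * fun p => Real.exp (ε * σ₀ * p.2.2))
        (fun p => entry U 0 0 p - 1) ∧
      SmoothBigO (Filter.comap (fun p : ℝ × ℝ × ℝ => p.2.2) T)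
        ((fun p => Real.exp (ε * σ₀ * p.2.2)) * fun p => Real.exp (ε * σ₀ * p.2.2))
        (fun p => entry U 0 1 p - ∑ r ∈ Finset.range M, b r *
          planeWave (Complex.I * j r) (Complex.I * l r) (ε * σ r + Complex.I * m)
            p.1 p.2.1 p.2.2)) :
    ConvergesTo T J (fun x y t => c • vacuumMap m x y t) ∧
    ∃ σ₀ > 0, ∃ γ η, γ.re = ε * σ₀ ∧ IsLinearMode (fun x y t => c • vacuumMap m x y t) γ η ∧
      TangentTo T J (fun x y t => c • vacuumMap m x y t) γ η := by
  -- The smallest rate is the leading one and fixes the weight at which `hexp` is used.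
  obtain ⟨r₀, hr₀, hmin⟩ := Finset.exists_min_image (Finset.range M) σ ⟨0, Finset.mem_range.2 hM⟩
  have hr₀' := Finset.mem_range.1 hr₀
  obtain ⟨σ₀, hσ₀⟩ : ∃ σ₀, σ₀ = σ r₀ := ⟨_, rfl⟩
  have hσ₀pos : 0 < σ₀ := hσ₀ ▸ hσ r₀ hr₀'
  have hle : ∀ r < M, σ₀ ≤ σ r := fun r hr => hσ₀ ▸ hmin r (Finset.mem_range.2 hr)
  obtain ⟨b, hb, h00, h01⟩ := hexp σ₀ hσ₀pos hle
  -- A rate strictly above the slowest, but at most the next larger σ and at most 2σ₀: both the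
  -- faster waves and the quadratic remainder are then O(e^{ερt}).
  obtain ⟨ρ, hρ, hρ2, hρσ⟩ : ∃ ρ, σ₀ < ρ ∧ ρ ≤ 2 * σ₀ ∧ ∀ r < M, σ r ≠ σ₀ → ρ ≤ σ r := by
    have hne : (insert (2 * σ₀)
        (((Finset.range M).filter fun r => σ r ≠ σ₀).image σ)).Nonempty :=
      Finset.insert_nonempty _ _
    refine ⟨_, ?_, Finset.min'_le _ _ (Finset.mem_insert_self _ _), fun r hr hne' =>
      Finset.min'_le _ _ (Finset.mem_insert_of_mem (Finset.mem_image_of_mem σ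
        (Finset.mem_filter.2 ⟨Finset.mem_range.2 hr, hne'⟩)))⟩
    rw [Finset.lt_min'_iff _ hne]
    intro x hx
    rcases Finset.mem_insert.1 hx with rfl | hx
    · linarith
    · obtain ⟨r, hr, rfl⟩ := Finset.mem_image.1 hx
      obtain ⟨hr1, hr2⟩ := Finset.mem_filter.1 hr
      exact lt_of_le_of_ne (hle r (Finset.mem_range.1 hr1)) (Ne.symm hr2)
  have hww : ((fun p : ℝ × ℝ × ℝ => Real.exp (ε * σ₀ * p.2.2))
      * fun p => Real.exp (ε * σ₀ * p.2.2)) = fun p => Real.exp (ε * (2 * σ₀) * p.2.2) := by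
    funext p
    rw [Pi.mul_apply, ← Real.exp_add]
    ring_nf
  rw [hww] at h00 h01
  obtain ⟨S, hS⟩ : ∃ S, S = (Finset.range M).filter fun r => σ r = σ₀ := ⟨_, rfl⟩
  have hSM : ∀ r ∈ S, r < M ∧ σ r = σ₀ := fun r hr => by
    rw [hS, Finset.mem_filter, Finset.mem_range] at hr
    exact hr
  obtain ⟨γ, hγ⟩ : ∃ γ : ℂ, γ = ε * σ₀ + Complex.I * m := ⟨_, rfl⟩
  have hγre : γ.re = ε * σ₀ := by simp [hγ]
  obtain ⟨f, hf⟩ : ∃ f, f = waveSum S b (fun r => Complex.I * j r) (fun r => Complex.I * l r) γ :=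
    ⟨_, rfl⟩
  have hpw : ∀ r < M, SmoothBigO (Filter.comap (fun p : ℝ × ℝ × ℝ => p.2.2) T)
      (fun p => Real.exp (ε * σ r * p.2.2)) (fun p => b r *
        planeWave (Complex.I * j r) (Complex.I * l r) (ε * σ r + Complex.I * m)
          p.1 p.2.1 p.2.2) := by
    intro r hr
    have := (smoothBigO_planeWave (l := Filter.comap (fun p : ℝ × ℝ × ℝ => p.2.2) T)
      (j r) (l r) (ε * σ r + Complex.I * m)).const_mul (b r)
    simpa using this
  have hrest : SmoothBigO (Filter.comap (fun p : ℝ × ℝ × ℝ => p.2.2) T)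
      (fun p => Real.exp (ε * ρ * p.2.2)) (fun p => entry U 0 1 p - f p.1 p.2.1 p.2.2) := by
    refine ((h01.mono (isBigO_exp_weight hT hρ2)).add (SmoothBigO.sum
      ((Finset.range M).filter fun r => ¬ σ r = σ₀) fun r hr => ((hpw r (Finset.mem_range.1
        (Finset.mem_filter.1 hr).1)).mono (isBigO_exp_weight hT (hρσ r (Finset.mem_range.1
          (Finset.mem_filter.1 hr).1) (Finset.mem_filter.1 hr).2))))).congr fun p => ?_
    have hfp : f p.1 p.2.1 p.2.2 = ∑ r ∈ (Finset.range M).filter (fun r => σ r = σ₀), b r *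
        planeWave (Complex.I * j r) (Complex.I * l r) (ε * σ r + Complex.I * m)
          p.1 p.2.1 p.2.2 := by
      rw [hf, waveSum, ← hS]
      exact Finset.sum_congr rfl fun r hr => by rw [hγ, (hSM r hr).2]
    rw [Pi.add_apply, Finset.sum_apply, hfp,
      ← Finset.sum_filter_add_sum_filter_not (Finset.range M) (fun r => σ r = σ₀)]
    ring
  obtain ⟨Z, hZ⟩ : ∃ Z : ℝ → ℝ → Matrix (Fin 2) (Fin 2) ℂ, Z = fun x y => upper f x y 0 :=
    ⟨_, rfl⟩
  have hmode : modeField γ Z = upper f := by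
    funext x y t
    have h : Complex.exp (γ * t) * f x y 0 = f x y t := by
      rw [hf, waveSum, waveSum, Finset.mul_sum]
      refine Finset.sum_congr rfl fun r _ => ?_
      rw [planeWave, planeWave, mul_left_comm, ← Complex.exp_add]
      congr 2
      simp
      ring
    ext a d
    fin_cases a <;> fin_cases d <;> simp [modeField, hZ, upper, h]
  have hη : realMode γ Z = fun x y t => !![0, f x y t; -conj (f x y t), 0] := by
    funext x y t
    rw [realMode, hmode]
    ext a d
    fin_cases a <;> fin_cases d <;> simp [upper]
  have hUe := fun p : ℝ × ℝ × ℝ => specialUnitary_entries (hU p.1 p.2.1 p.2.2)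
  have hrem : ∀ a d, SmoothBigO (Filter.comap (fun p : ℝ × ℝ × ℝ => p.2.2) T)
      (fun p => Real.exp (ε * ρ * p.2.2)) (entry (U - 1 - realMode γ Z) a d) := by
    have h00' := h00.mono (isBigO_exp_weight hT hρ2)
    intro a d
    rw [hη]
    fin_cases a <;> fin_cases d
    · exact h00'.congr fun p => by simp [entry]
    · exact hrest.congr fun p => by simp [entry]
    · exact hrest.conjugate.neg.congr fun p => by
        simp [entry, (hUe p).2]
        ring
    · exact h00'.conjugate.congr fun p => by simp [entry, (hUe p).1]
  have hf0 : SmoothBigO (Filter.comap (fun p : ℝ × ℝ × ℝ => p.2.2) T)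
      (fun p => Real.exp (ε * σ₀ * p.2.2)) (fun p => f p.1 p.2.1 p.2.2) := by
    refine (SmoothBigO.sum S fun r hr => (hpw r (hSM r hr).1).mono
      (isBigO_exp_weight hT (hSM r hr).2.ge)).congr fun p => ?_
    rw [Finset.sum_apply, hf, waveSum]
    exact Finset.sum_congr rfl fun r hr => by rw [hγ, (hSM r hr).2]
  have hη0 : ∀ a d, SmoothBigO (Filter.comap (fun p : ℝ × ℝ × ℝ => p.2.2) T)
      (fun p => Real.exp (ε * σ₀ * p.2.2)) (entry (realMode γ Z) a d) := by
    intro a d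
    rw [hη]
    fin_cases a <;> fin_cases d
    · exact SmoothBigO.zero.congr fun p => by simp [entry]
    · exact hf0.congr fun p => by simp [entry]
    · exact hf0.conjugate.neg.congr fun p => by simp [entry]
    · exact SmoothBigO.zero.congr fun p => by simp [entry]
  have hU1 : ∀ a d, SmoothBigO (Filter.comap (fun p : ℝ × ℝ × ℝ => p.2.2) T)
      (fun p => Real.exp (ε * σ₀ * p.2.2)) (entry (U - 1) a d) := fun a d =>
    (((hrem a d).mono (isBigO_exp_weight hT hρ.le)).add (hη0 a d)).congr fun p => by
      simp [entry]
  refine ⟨?_, σ₀, hσ₀pos, γ, realMode γ Z, hγre, ⟨Z, ?_, ?_, ?_, ?_, rfl, ?_⟩, ?_⟩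
  · refine smoothLittleO_of_smoothBigO (w := fun p => Real.exp (ε * σ₀ * p.2.2)) (fun a d => ?_)
      ((Asymptotics.isLittleO_one_iff ℝ).2 (tendsto_exp_weight hT hσ₀pos)) fun _ => zero_le_one
    have : J - (fun x y t => c • vacuumMap m x y t)
        = (fun x y t => c • vacuumMap m x y t) * (U - 1) := by
      rw [hJ, mul_sub, mul_one]
    rw [this]
    exact smoothBigO_entry_mul (smoothBigO_vacuumMap m c) hU1 a d
  · rw [hmode, hf]
    exact smooth_upper contDiff_waveSum
  · rw [hmode, hf]
    intro x y t
    simp only [upper, waveSum, planeWave_periodic, and_self]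
  · intro x y
    simp [hZ, upper, Matrix.trace_fin_two]
  · rw [hmode, hf]
    -- With γ = εσ₀ + im, γ² − 2imγ = σ₀² + m², and the dispersion relation becomes the formula for
    -- σ².
    refine linWardOp_upper_waveSum hc fun r hr => ?_
    obtain ⟨hr1, hr2⟩ := hSM r hr
    have h := hσ2 r hr1
    rw [hr2] at h
    have h' : (σ₀ : ℂ) ^ 2 = m ^ 2 - (j r - m) ^ 2 - (l r - m) ^ 2 := by exact_mod_cast h
    have hε' : (ε : ℂ) ^ 2 = 1 := by exact_mod_cast hε
    rw [hγ]
    linear_combination h' + σ₀ ^ 2 * hε'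
      + (-(m : ℂ) ^ 2 - j r ^ 2 - l r ^ 2 + 2 * m * j r + 2 * m * l r) * Complex.I_sq
  · intro h0
    have hr₀S : r₀ ∈ S := by
      rw [hS, Finset.mem_filter]
      exact ⟨hr₀, hσ₀.symm⟩
    obtain ⟨x, y, hxy⟩ := exists_waveSum_ne_zero (γ := γ) hr₀S (hb r₀ hr₀')
      fun r hr k hk => hinj r (hSM r hr).1 k (hSM k hk).1
    apply hxy
    rw [hη] at h0
    have := congrFun (congrFun (congrFun (congrFun (congrFun h0 x) y) 0) 0) 1
    rw [← hf]
    simpa using this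
  · refine smoothLittleO_of_smoothBigO (w := fun p => Real.exp (ε * ρ * p.2.2)) (fun a d => ?_)
      ?_ fun _ => (Real.exp_pos _).le
    · have : (fun x y t => J x y t - c • vacuumMap m x y t * (1 + realMode γ Z x y t))
          = (fun x y t => c • vacuumMap m x y t) * (U - 1 - realMode γ Z) := by
        rw [sub_sub, mul_sub, hJ]
        rfl
      rw [this]
      exact smoothBigO_entry_mul (smoothBigO_vacuumMap m c) hrem a d
    · rw [hγre]
      exact isLittleO_exp_weight hT hρ

end Ward

namespace Ward

/-! ### The homoclinic Ward maps -/

theorem smul_mem_specialUnitaryGroup {c : ℂ} (hc : c = 1 ∨ c = -1) {A : Matrix (Fin 2) (Fin 2) ℂ}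
    (hA : A ∈ Matrix.specialUnitaryGroup (Fin 2) ℂ) :
    c • A ∈ Matrix.specialUnitaryGroup (Fin 2) ℂ := by
  obtain ⟨h1, h2⟩ := Matrix.mem_specialUnitaryGroup_iff.1 hA
  rw [Matrix.mem_unitaryGroup_iff] at h1
  rw [Matrix.mem_specialUnitaryGroup_iff, Matrix.mem_unitaryGroup_iff, Matrix.det_smul, h2]
  rcases hc with rfl | rfl <;> simp [h1]

theorem conjTranspose_mem_specialUnitaryGroup {A : Matrix (Fin 2) (Fin 2) ℂ}
    (hA : A ∈ Matrix.specialUnitaryGroup (Fin 2) ℂ) :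
    Aᴴ ∈ Matrix.specialUnitaryGroup (Fin 2) ℂ := by
  obtain ⟨h1, h2⟩ := Matrix.mem_specialUnitaryGroup_iff.1 hA
  rw [Matrix.mem_specialUnitaryGroup_iff, Matrix.det_conjTranspose, h2, star_one]
  exact ⟨Unitary.star_mem h1, rfl⟩

theorem isTorusWardMap_smul_vacuumMap (m : ℤ) {c : ℂ} (hc : c = 1 ∨ c = -1) :
    IsTorusWardMap (fun x y t => c • vacuumMap m x y t) := by
  have hL : Smooth (fun x y t => c • vacuumMap m x y t) := (smooth_vacuumMap m).const_smul c
  have hSU : ∀ x y t, c • vacuumMap m x y t ∈ Matrix.specialUnitaryGroup (Fin 2) ℂ :=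
    fun x y t => smul_mem_specialUnitaryGroup hc (vacuumMap_mem_SU m x y t)
  have hdir : ∀ v : ℝ × ℝ × ℝ, v.1 + v.2.1 = 1 → dir v (fun x y t => c • vacuumMap m x y t)
      = (fun x y t => c • vacuumMap m x y t) * vacuumConn m := by
    intro v hv
    have hv' : (v.1 + v.2.1 : ℂ) = 1 := by exact_mod_cast hv
    have := dir_const_smul c (smooth_vacuumMap m) v
    rw [dir_vacuumMap, ← smul_mul_assoc, hv', neg_smul, one_smul] at this
    exact this
  refine ⟨hL, fun x y t => ?_, hSU, fun x y t => ?_⟩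
  · simp only [vacuumMap_periodic m x y t, and_self]
  · rw [wardOp_eq_zero hL (smooth_const (-aMat m)) (fun x y t => ?_) (hdir dirU (by simp [dirU]))
      (hdir dirX (by simp [dirX]))
      ((dir_const (-aMat m) dirV).trans (dir_const (-aMat m) dirX).symm)]
    · rfl
    · rw [(Matrix.mem_specialUnitaryGroup_iff.1 (hSU x y t)).2]
      exact isUnit_one

variable {m : ℤ} {j l : ℕ → ℤ} {z : ℕ → ℂ} {N : ℕ}

/-! ### Decay of the seeds and the homoclinic property. -/

theorem smoothBigO_seeds {T : Filter ℝ} (hT : Filter.Tendsto (fun t => 1 * t) T Filter.atBot)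
    {s : ℕ} {σ₀ : ℝ} (h : σ₀ ≤ growthRate m (j s) (l s)) :
    SmoothBigO (Filter.comap (fun p : ℝ × ℝ × ℝ => p.2.2) T)
      (fun p => Real.exp (1 * σ₀ * p.2.2)) (fun p => seeds m j l s p.1 p.2.1 p.2.2) := by
  have h1 := smoothBigO_planeWave (l := Filter.comap (fun p : ℝ × ℝ × ℝ => p.2.2) T)
    (-j s) (-l s) (growthRate m (j s) (l s) - Complex.I * m)
  have h2 : SmoothBigO (Filter.comap (fun p : ℝ × ℝ × ℝ => p.2.2) T)
      (fun p => Real.exp (1 * growthRate m (j s) (l s) * p.2.2))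
      (fun p => seeds m j l s p.1 p.2.1 p.2.2) := by
    simpa [seeds, seedRatio] using h1
  exact h2.mono (isBigO_exp_weight hT h)

theorem inv_seeds (s : ℕ) (x y t : ℝ) : (seeds m j l s x y t)⁻¹ = planeWave (Complex.I * j s)
    (Complex.I * l s) (-growthRate m (j s) (l s) + Complex.I * m) x y t := by
  rw [seeds, seedRatio, planeWave_inv]
  ring_nf

theorem conj_seeds (s : ℕ) (x y t : ℝ) : conj (seeds m j l s x y t) = planeWave (Complex.I * j s)
    (Complex.I * l s) (growthRate m (j s) (l s) + Complex.I * m) x y t := by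
  rw [seeds, seedRatio, conj_planeWave]
  simp

theorem smoothBigO_inv_seeds {T : Filter ℝ}
    (hT : Filter.Tendsto (fun t => -1 * t) T Filter.atBot)
    {s : ℕ} {σ₀ : ℝ} (h : σ₀ ≤ growthRate m (j s) (l s)) :
    SmoothBigO (Filter.comap (fun p : ℝ × ℝ × ℝ => p.2.2) T)
      (fun p => Real.exp (-1 * σ₀ * p.2.2)) (fun p => (seeds m j l s p.1 p.2.1 p.2.2)⁻¹) := by
  have h1 := smoothBigO_planeWave (l := Filter.comap (fun p : ℝ × ℝ × ℝ => p.2.2) T)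
    (j s) (l s) (-growthRate m (j s) (l s) + Complex.I * m)
  have h2 : SmoothBigO (Filter.comap (fun p : ℝ × ℝ × ℝ => p.2.2) T)
      (fun p => Real.exp (-1 * growthRate m (j s) (l s) * p.2.2))
      (fun p => (seeds m j l s p.1 p.2.1 p.2.2)⁻¹) := by
    simp only [inv_seeds]
    simpa using h1
  exact h2.mono (isBigO_exp_weight hT h)

theorem PoleData.isHomoclinicTo (h : PoleData m j l z (2 * N)) (hp : PairedPoles z N)
    (hN : 1 ≤ N) : IsHomoclinicTo (dressMap z (seeds m j l) (vacuumMap m) (2 * N))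
      (fun x y t => (-1 : ℂ) ^ N • vacuumMap m x y t) := by
  have hz := h.admissible
  have hz0 : ∀ r < 2 * N, z (r + 1) ≠ 0 := fun r hr => hz.ne_zero hr
  have hc : (-1 : ℂ) ^ N = 1 ∨ (-1 : ℂ) ^ N = -1 := neg_one_pow_eq_or ℂ N
  have hc0 : (-1 : ℂ) ^ N ≠ 0 := pow_ne_zero _ (by simp)
  have hJG := dressMap_mul_dressing (q := seeds m j l) (J := vacuumMap m) hz le_rfl
  rw [hp.prod_unit hz0] at hJG
  have hward := h.isTorusWardMap le_rfl
  obtain ⟨J, hJ⟩ : ∃ J, J = dressMap z (seeds m j l) (vacuumMap m) (2 * N) := ⟨_, rfl⟩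
  obtain ⟨G, hG⟩ : ∃ G, G = dressing z (seeds m j l) (2 * N) 0 := ⟨_, rfl⟩
  rw [← hJ] at hward
  rw [← hJ, ← hG] at hJG
  rw [← hJ]
  have hGSU : ∀ x y t, G x y t ∈ Matrix.specialUnitaryGroup (Fin 2) ℂ := by
    intro x y t
    have h1 : J x y t * G x y t = (-1 : ℂ) ^ N • vacuumMap m x y t :=
      congrFun (congrFun (congrFun hJG x) y) t
    have h2 : (J x y t)ᴴ * J x y t = 1 := Matrix.mem_unitaryGroup_iff'.1
      (Matrix.mem_specialUnitaryGroup_iff.1 (hward.mem_SU x y t)).1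
    have h3 : G x y t = (J x y t)ᴴ * ((-1 : ℂ) ^ N • vacuumMap m x y t) := by
      rw [← h1, ← Matrix.mul_assoc, h2, one_mul]
    rw [h3]
    exact mul_mem (conjTranspose_mem_specialUnitaryGroup (hward.mem_SU x y t))
      (smul_mem_specialUnitaryGroup hc (vacuumMap_mem_SU m x y t))
  have hGG : G * star G = 1 := by
    funext x y t
    exact Matrix.mem_unitaryGroup_iff.1 (Matrix.mem_specialUnitaryGroup_iff.1 (hGSU x y t)).1
  -- G is unitary, so J·G = (−1)^N J₀ can be solved for J; U = G* is the matrix to be expanded.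
  have hJU : J = (fun x y t => (-1 : ℂ) ^ N • vacuumMap m x y t) * star G := by
    have := congrArg (· * star G) hJG
    simp only [mul_assoc, hGG, mul_one] at this
    exact this
  have hUSU : ∀ x y t, star G x y t ∈ Matrix.specialUnitaryGroup (Fin 2) ℂ := fun x y t =>
    conjTranspose_mem_specialUnitaryGroup (hGSU x y t)
  have hU : ∀ a b p, entry (star G) a b p = conj (entry G b a p) := fun a b p => rfl
  have hμ : ∀ r < 2 * N, (0 : ℂ) ≠ z (r + 1) := fun r hr => (hz0 r hr).symm
  have hμ' : ∀ r < 2 * N, (0 : ℂ) ≠ conj (z (r + 1)) := fun r hr =>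
    ((map_ne_zero _).2 (hz0 r hr)).symm
  have hσ : ∀ r < 2 * N, 0 < growthRate m (j (r + 1)) (l (r + 1)) := fun r hr =>
    growthRate_pos (h.disc r hr)
  have hσ2 : ∀ r < 2 * N, growthRate m (j (r + 1)) (l (r + 1)) ^ 2
      = m ^ 2 - (j (r + 1) - m) ^ 2 - (l (r + 1) - m) ^ 2 := fun r hr =>
    sq_growthRate (h.disc r hr)
  have hTneg : Filter.Tendsto (fun t : ℝ => 1 * t) Filter.atBot Filter.atBot := by
    simp only [one_mul]
    exact Filter.tendsto_id
  have hTpos : Filter.Tendsto (fun t : ℝ => -1 * t) Filter.atTop Filter.atBot := by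
    simpa using Filter.tendsto_neg_atTop_atBot
  obtain ⟨hconv1, σ₁, hσ₁, γ₁, η₁, hγ₁, hη₁, htan₁⟩ := exists_tangent_mode
    (j := fun r => j (r + 1)) (l := fun r => l (r + 1)) (M := 2 * N) hTneg (by norm_num)
    (by omega) hσ hσ2 h.distinct hc0 hJU hUSU (fun σ₀ hσ₀ hle => by
      obtain ⟨K, hK, hexp⟩ := dressing_asymptotics hz (tendsto_exp_weight hTneg hσ₀)
        (fun s hs => smoothBigO_seeds hTneg (hle s hs)) le_rfl
      obtain ⟨e1, -, e3, -⟩ := hexp 0 hμ hμ'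
      rw [hp.blaschke_zero hz0, ← hG] at e1 e3
      -- The 1 is the Blaschke product at 0. Since U₀₁ is the conjugate of G₁₀, the seeds are
      -- conjugated, which gives frequencies (j, l) and exponent σ + im.
      refine ⟨fun r => conj (1 * (K r / (0 - z (r + 1)))), fun r hr => ?_, ?_, ?_⟩
      · rw [map_ne_zero, one_mul]
        exact div_ne_zero (hK r hr) (sub_ne_zero.2 (hμ r hr))
      · exact e1.conjugate.congr fun p => by rw [hU, map_sub, map_one]
      · refine e3.conjugate.congr fun p => ?_
        rw [hU, map_sub, map_sum]
        simp only [map_mul, conj_seeds, Complex.ofReal_one, one_mul])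
  obtain ⟨hconv2, σ₂, hσ₂, γ₂, η₂, hγ₂, hη₂, htan₂⟩ := exists_tangent_mode
    (j := fun r => j (r + 1)) (l := fun r => l (r + 1)) (M := 2 * N) hTpos (by norm_num)
    (by omega) hσ hσ2 h.distinct hc0 hJU hUSU (fun σ₀ hσ₀ hle => by
      obtain ⟨K, hK, hexp⟩ := dressing_asymptotics
        (q := fun s x y t => (seeds m j l s x y t)⁻¹) hz (tendsto_exp_weight hTpos hσ₀)
        (fun s hs => smoothBigO_inv_seeds hTpos (hle s hs)) le_rfl
      obtain ⟨-, -, e3, e4⟩ := hexp 0 hμ hμ'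
      rw [hp.blaschke_zero hz0] at e3
      obtain ⟨G', hG'⟩ : ∃ G', G' = dressing z (fun s x y t => (seeds m j l s x y t)⁻¹) (2 * N) 0 :=
        ⟨_, rfl⟩
      rw [← hG'] at e3 e4
      have hswap : ∀ p : ℝ × ℝ × ℝ, G p.1 p.2.1 p.2.2
          = swapMat * G' p.1 p.2.1 p.2.2 * swapMat := fun p => by
        rw [hG, hG']
        exact dressing_eq_swapMat (fun s x y t => planeWave_ne_zero x y t) _ _ _ _ _
      have h00 : ∀ p, entry G 0 0 p = entry G' 1 1 p := fun p => by
        simp [entry, hswap p, swapMat_mul_mul]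
      have h01 : ∀ p, entry G 0 1 p = entry G' 1 0 p := fun p => by
        simp [entry, hswap p, swapMat_mul_mul]
      refine ⟨fun r => -(1 * (K r / (0 - z (r + 1)))), fun r hr => ?_, ?_, ?_⟩
      · rw [neg_ne_zero, one_mul]
        exact div_ne_zero (hK r hr) (sub_ne_zero.2 (hμ r hr))
      · exact e4.conjugate.congr fun p => by rw [hU, map_sub, map_one, h00]
      · refine e3.neg.congr fun p => ?_
        -- Here U₀₁ = conj G₁₀ = −G₀₁ = −G′₁₀, with no conjugation left: 1/q already has frequencies
        -- (j, l) and exponent −σ + im.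
        have hent : entry G 1 0 p = -conj (entry G 0 1 p) :=
          (specialUnitary_entries (hGSU p.1 p.2.1 p.2.2)).2
        rw [Pi.neg_apply, hU, hent, map_neg, Complex.conj_conj, h01, neg_sub]
        simp only [inv_seeds, neg_mul, Finset.sum_neg_distrib, Complex.ofReal_neg,
          Complex.ofReal_one, one_mul]
        ring)
  exact ⟨hward, isTorusWardMap_smul_vacuumMap m hc, fun x y t => rfl, hconv1, hconv2,
    ⟨γ₁, η₁, by rw [hγ₁]; linarith, hη₁, htan₁⟩, ⟨γ₂, η₂, by rw [hγ₂]; linarith, hη₂, htan₂⟩⟩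

end Ward

/-! ### The theorem: verification of the pole data. -/

theorem mainTheorem4 (m : ℤ) (hm : m ≠ 0) (N : ℕ) (hN : 1 ≤ N) (j l : ℕ → ℤ) (θ : ℕ → ℝ)
    (hdisc : ∀ k ∈ Finset.Icc 1 N,
      (j (2 * k - 1) - m) ^ 2 + (l (2 * k - 1) - m) ^ 2 < m ^ 2 ∧ m < l (2 * k - 1))
    (hdist : ∀ k h, 1 ≤ k → k < h → h ≤ N →
      (j (2 * k - 1), l (2 * k - 1)) ≠ (j (2 * h - 1), l (2 * h - 1)))
    (hpair : ∀ k ∈ Finset.Icc 1 N,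
      j (2 * k) = j (2 * k - 1) ∧ l (2 * k) = 2 * m - l (2 * k - 1))
    (hcos : ∀ s ∈ Finset.Icc 1 (2 * N),
      Real.cos (θ s) = (m.sign : ℝ) * ((l s - m) / Real.sqrt (j s * (2 * m - j s))))
    (hsin : ∀ s ∈ Finset.Icc 1 (2 * N),
      Real.sin (θ s) = (m.sign : ℝ) * Real.sqrt (1 - Real.cos (θ s) ^ 2)) :
    Ward.IsTorusWardMap (Ward.solitonMap m j θ (2 * N)) ∧
    Ward.IsHomoclinicTo (Ward.solitonMap m j θ (2 * N))
      (fun x y t => (-1 : ℂ) ^ N • Ward.vacuumMap m x y t) ∧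
    Ward.ConvergesTo Filter.atBot (Ward.solitonMap m j θ (2 * N))
      (fun x y t => (-1 : ℂ) ^ N • Ward.vacuumMap m x y t) ∧
    Ward.ConvergesTo Filter.atTop (Ward.solitonMap m j θ (2 * N))
      (fun x y t => (-1 : ℂ) ^ N • Ward.vacuumMap m x y t) := by
  have hodd : ∀ k < N, (j (2 * k + 1) - m) ^ 2 + (l (2 * k + 1) - m) ^ 2 < m ^ 2 ∧
      m < l (2 * k + 1) := fun k hk => by
    simpa [mul_add] using hdisc (k + 1) (Finset.mem_Icc.2 ⟨by omega, by omega⟩)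
  have heven : ∀ k < N, j (2 * k + 2) = j (2 * k + 1) ∧ l (2 * k + 2) = 2 * m - l (2 * k + 1) :=
    fun k hk => by
      simpa [mul_add] using hpair (k + 1) (Finset.mem_Icc.2 ⟨by omega, by omega⟩)
  have hne : ∀ k < N, ∀ h < N, k ≠ h →
      (j (2 * k + 1), l (2 * k + 1)) ≠ (j (2 * h + 1), l (2 * h + 1)) := by
    have hlt : ∀ k h, k < h → h < N →
        (j (2 * k + 1), l (2 * k + 1)) ≠ (j (2 * h + 1), l (2 * h + 1)) := fun k h hkh hh =>
      hdist (k + 1) (h + 1) (by omega) (by omega) (by omega)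
    intro k hk h hh hkh
    rcases lt_or_gt_of_ne hkh with h' | h'
    · exact hlt k h h' hh
    · exact (hlt h k h' hk).symm
  have hparity : ∀ s < 2 * N, ∃ k < N, s = 2 * k ∨ s = 2 * k + 1 := fun s hs =>
    ⟨s / 2, by omega, by omega⟩
  have hd : ∀ s < 2 * N, (j (s + 1) - m) ^ 2 + (l (s + 1) - m) ^ 2 < m ^ 2 := by
    intro s hs
    obtain ⟨k, hk, rfl | rfl⟩ := hparity s hs
    · exact (hodd k hk).1
    · rw [(heven k hk).1, (heven k hk).2]
      have := (hodd k hk).1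
      linarith
  have hspec := fun s (hs : s < 2 * N) => Ward.pole_spec (hd s hs)
    (hcos (s + 1) (Finset.mem_Icc.2 ⟨by omega, by omega⟩))
    (hsin (s + 1) (Finset.mem_Icc.2 ⟨by omega, by omega⟩))
  have hdata : Ward.PoleData m j l (fun s => Ward.pole m (j s) (θ s)) (2 * N) := by
    refine ⟨hd, fun s hs => (hspec s hs).1, fun s hs => (hspec s hs).2.1,
      fun s hs => (hspec s hs).2.2, fun r hr s hs hrs he => ?_⟩
    obtain ⟨k, hk, rfl | rfl⟩ := hparity r hr <;> obtain ⟨h, hh, rfl | rfl⟩ := hparity s hs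
    · exact hne k hk h hh (by omega) he
    -- Labels of different parity: l > m for the odd one, l < m for the even one.
    · have h1 := (hodd k hk).2
      have h2 := (hodd h hh).2
      have h3 := (Prod.ext_iff.1 he).2
      simp only [(heven h hh).2] at h3
      omega
    · have h1 := (hodd k hk).2
      have h2 := (hodd h hh).2
      have h3 := (Prod.ext_iff.1 he).2
      simp only [(heven k hk).2] at h3
      omega
    · refine hne k hk h hh (by omega) ?_
      obtain ⟨h3, h4⟩ := Prod.ext_iff.1 he
      simp only [(heven k hk).1, (heven h hh).1, (heven k hk).2, (heven h hh).2] at h3 h4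
      exact Prod.ext h3 (by simp only; omega)
  -- Reflecting l in m keeps j and σ and changes the sign of l − m, so jz = l − m + iσ becomes minus
  -- its conjugate.
  have hpaired : Ward.PairedPoles (fun s => Ward.pole m (j s) (θ s)) N := by
    intro k hk
    have h1 := hdata.mul_pole (2 * k) (by omega)
    have h2 := hdata.mul_pole (2 * k + 1) (by omega)
    have hj : (j (2 * k + 1) : ℂ) ≠ 0 := by exact_mod_cast hdata.ne_zero (2 * k) (by omega)
    have hg : Ward.growthRate m (j (2 * k + 2)) (l (2 * k + 2))
        = Ward.growthRate m (j (2 * k + 1)) (l (2 * k + 1)) := by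
      rw [Ward.growthRate, Ward.growthRate, (heven k hk).1, (heven k hk).2]
      congr 1
      push_cast
      ring
    have h3 := congrArg (starRingEnd ℂ) h1
    simp only [map_mul, map_add, map_sub, map_intCast, Complex.conj_I, Complex.conj_ofReal] at h3
    apply mul_left_cancel₀ hj
    simp only [show 2 * k + 1 + 1 = 2 * k + 2 from rfl, hg] at h2
    rw [(heven k hk).2] at h2
    have hj2 : (j (2 * k + 2) : ℂ) = j (2 * k + 1) := by rw [(heven k hk).1]
    rw [← hj2] at h3 ⊢
    push_cast at h2
    linear_combination h2 + h3
  have hhom := hdata.isHomoclinicTo hpaired hN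
  have heq : Ward.solitonMap m j θ (2 * N) = _ := hdata.iterMap_eq le_rfl
  rw [heq]
  exact ⟨hhom.wardMap, hhom, hhom.tendsto_neg, hhom.tendsto_pos⟩
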